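/- **Setting.** Let $\epsilon>0$ and let $K$ be $2\epsilon^{-1/2}$ rounded (up or down) to an integer. In a separable real Hilbert space consider, with respect to an orthonormal system, $$w^*=(1,1,0,0,\dots)^\top,\quad \sigma^2=1,\quad H=\mathrm{diag}(1,\underbrace{\epsilon^{0.5},\dots,\epsilon^{0.5}}_{K\text{ copies}},0,0,\dots),\quad G=\mathrm{diag}(\epsilon^2,1,0,0,\dots).$$ The source and target covariate laws have finite fourth moments $\mathbb E\|x\|^4<\infty$ and second moments $\mathbb E_{\rm source}[xx^\top]=G$, $\mathbb E_{\rm target}[xx^\top]=H$; in both domains $y=\langle w^*,x\rangle+\xi$ with $\xi\sim\mathcal N(0,1)$ independent of $x$. Given $M$ source data followed by $N$ target data, all independent, SGD starts at $w_0=0$ and iterates $$w_t=w_{t-1}-\gamma_{t-1}(x_tx_t^\top w_{t-1}-x_ty_t),\quad t=1,\dots,M+N,$$ where $\gamma_t=\gamma_0/2^{\lfloor t/(M/\log M)\rfloor}$ for $0\le t<M$ and $\gamma_t=\gamma_M/2^{\lfloor (t-M)/(N/\log N)\rfloor}$ for $M\le t<M+N$ (natural logarithm; the exponent is read as $0$ for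 a phase of length one). Let $R_{\rm target}(w)=\tfrac12\mathbb E_{\rm target}(y-\langle w,x\rangle)^2$ and let $\Delta(M,N)=\mathbb E[R_{\rm target}(w_{M+N})]-R_{\rm target}(w^*)$ be the expected target excess risk of the output. The initial stepsizes are positive. **Claim.** For all sufficiently small $\epsilon$, $\mathrm{tr}(H)\eqsim\mathrm{tr}(G)\eqsim 1$ and $\|w^*\|_H^2\eqsim\|w^*\|_G^2\eqsim1$, and: * **Supervised learning.** There are absolute constants $c,\epsilon_0>0$ such that for all $\epsilon<\epsilon_0$, all such laws, all $N$ and all initial stepsizes $\gamma_M<1/\|H\|_2$: if $\Delta(0,N)<\epsilon$ then $N\ge c\,\epsilon^{-1.5}$. * **Pretraining.** There are absolute constants $c,\epsilon_0>0$ such that for all $\epsilon<\epsilon_0$, all such laws, all $M$ and all initial stepsizes $\gamma_0<1/\|G\|_2$: if $\Delta(M,0)<\epsilon$ then $M\ge c\,\epsilon^{-2}$. * **Pretraining–finetuning.** There is an absolute constant $\kappa>0$ such that for every $\alpha>0$ and all constants $a_0,a_1,a_2,a_3>0$ and $b_1,b_2,b_3$ with $a_1a_3\ge\kappa$ there is $\epsilon_0>0$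 such that the following holds for all $\epsilon<\epsilon_0$. Suppose that the covariate laws also satisfy $\mathbb E_{\rm source}[xx^\top Axx^\top]\preceq\alpha\,\mathrm{tr}(GA)\,G$ and $\mathbb E_{\rm target}[xx^\top Axx^\top]\preceq\alpha\,\mathrm{tr}(HA)\,H$ for every bounded positive semidefinite $A$. If $$a_0\le\gamma_0<\min\Big\{\tfrac1{4\alpha\,\mathrm{tr}(G)},\tfrac1{4\alpha\,\mathrm{tr}(H)}\Big\},\quad a_1\epsilon\le\gamma_M\le b_1\epsilon,$$ $$a_2\,\epsilon^{-1}\log(\epsilon^{-1})\le M\le b_2\,\epsilon^{-1}\log(\epsilon^{-1}),\quad a_3\,\epsilon^{-1}\log^2(\epsilon^{-1})\le N\le b_3\,\epsilon^{-1}\log^2(\epsilon^{-1}),$$ then the excess risk of $w_{M+N}$ has finite expectation and $\Delta(M,N)<\epsilon$. That is, $\gamma_0\eqsim1$, $\gamma_M\eqsim\epsilon$, $M\eqsim\epsilon^{-1}\log(\epsilon^{-1})$, $N\eqsim\epsilon^{-1}\log^2(\epsilon^{-1})$ suffices, polynomially fewer data than either pretraining or supervised learning alone needs. -/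

import Mathlib

open MeasureTheory ProbabilityTheory

section Definitions

universe u

variable {E : Type u} [NormedAddCommGroup E] [InnerProductSpace ℝ E]

/-- The operator `∑ i, s i • e i (e i)ᵀ`; for an orthonormal family `e` this is
`diag (s 0, …, s (n-1), 0, 0, …)` in any orthonormal basis that extends `e`. -/
noncomputable def diagOp {n : ℕ} (e : Fin n → E) (s : Fin n → ℝ) : E →L[ℝ] E :=
  ∑ i, s i • InnerProductSpace.rankOne ℝ (e i) (e i)

/-- `tr (T A)` for `T = diagOp e s` and a bounded operator `A` (`e` orthonormal). -/
noncomputable def traceDiagMul {n : ℕ} (e : Fin n → E) (s : Fin n → ℝ) (A : E →L[ℝ] E) : ℝ :=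
  ∑ i, s i * inner ℝ (e i) (A (e i))

/-- `‖w‖²_T = wᵀ T w`. -/
noncomputable def normSqOp (T : E →L[ℝ] E) (w : E) : ℝ := inner ℝ w (T w)

/-- `(1, ε^{0.5}, …, ε^{0.5})` with `K` copies of `ε^{0.5}`. -/
noncomputable def targetSpectrum (ε : ℝ) (K : ℕ) (i : Fin (K + 1)) : ℝ :=
  if i = 0 then 1 else ε ^ (1 / 2 : ℝ)

/-- `(ε², 1, 0, …, 0)`. -/
noncomputable def sourceSpectrum (ε : ℝ) (K : ℕ) (i : Fin (K + 1)) : ℝ :=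
  if i = 0 then ε ^ 2 else if i = 1 then 1 else 0

/-- The stepsizes. In each of the two phases (of length `M` and `N`) the stepsize is halved after
every `M / log M` (respectively `N / log N`) steps. -/
noncomputable def stepSize (γ₀ γM : ℝ) (M N t : ℕ) : ℝ :=
  if t < M then γ₀ / 2 ^ ⌊(t : ℝ) / (M / Real.log M)⌋₊
  else γM / 2 ^ ⌊((t : ℝ) - M) / (N / Real.log N)⌋₊

/-- Online SGD from `0` for linear regression: step `t` uses the datum `z t = (x, y)`. -/
noncomputable def sgd (γ : ℕ → ℝ) (z : ℕ → E × ℝ) : ℕ → E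
  | 0 => 0
  | t + 1 => sgd γ z t
      - γ t • (inner ℝ (z t).1 (sgd γ z t) • (z t).1 - (z t).2 • (z t).1)

variable [MeasurableSpace E]

/-- The operator `T` is the (uncentred) covariance `𝔼[x xᵀ]` of the covariate law `P`. -/
def HasSecondMoment (P : Measure E) (T : E →L[ℝ] E) : Prop :=
  ∀ u v : E, ∫ x, inner ℝ u x * inner ℝ v x ∂P = inner ℝ u (T v)

/-- `𝔼[x xᵀ A x xᵀ] ≼ α · tr (T A) · T` for every positive semidefinite `A`, where
`T = diagOp e s`. -/
def FourthMomentUpper {n : ℕ} (α : ℝ) (P : Measure E) (e : Fin n → E) (s : Fin n → ℝ) : Prop :=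
  ∀ A : E →L[ℝ] E, A.IsPositive → ∀ v : E,
    ∫ x, (inner ℝ v x) ^ 2 * inner ℝ x (A x) ∂P
      ≤ α * traceDiagMul e s A * inner ℝ v (diagOp e s v)

/-- The law of `(x, y)` with `x ∼ P` and `y = ⟨w, x⟩ + ξ`, where `ξ ∼ 𝒩(0, 1)` is independent
of `x`. -/
noncomputable def dataLaw (P : Measure E) (w : E) : Measure (E × ℝ) :=
  (P.prod (gaussianReal 0 1)).map fun p => (p.1, inner ℝ w p.1 + p.2)

/-- The population risk `½ 𝔼 (y - ⟨w, x⟩)²`. -/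
noncomputable def risk (D : Measure (E × ℝ)) (w : E) : ℝ :=
  1 / 2 * ∫ p, (p.2 - inner ℝ w p.1) ^ 2 ∂D

instance dataLaw_isProbabilityMeasure [BorelSpace E] [SecondCountableTopology E]
    (P : Measure E) [IsProbabilityMeasure P] (w : E) : IsProbabilityMeasure (dataLaw P w) := by
  unfold dataLaw
  exact Measure.isProbabilityMeasure_map (by fun_prop)

/-- The law of the `t`-th datum (counted from `0`): source data first, then target data. -/
noncomputable def datumLaw (PS PT : Measure E) (w : E) (M t : ℕ) : Measure (E × ℝ) :=
  if t < M then dataLaw PS w else dataLaw PT w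

instance datumLaw_isProbabilityMeasure [BorelSpace E] [SecondCountableTopology E]
    (PS PT : Measure E) [IsProbabilityMeasure PS] [IsProbabilityMeasure PT] (w : E) (M t : ℕ) :
    IsProbabilityMeasure (datumLaw PS PT w M t) := by
  unfold datumLaw
  split_ifs <;> infer_instance

/-- The covariate shift problem instance: `G = diag (ε², 1, 0, …)`,
`H = diag (1, ε^{0.5}, …, ε^{0.5}, 0, …)` with `K` copies of `ε^{0.5}`, where `K` is `2 ε^{-0.5}`
rounded (up or down) to an integer, in an orthonormal system `e` of the Hilbert space `E`. The
covariate laws are `PS` (source) and `PT` (target). -/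
structure ShiftInstance (ε : ℝ) (E : Type u) [NormedAddCommGroup E] [InnerProductSpace ℝ E]
    [MeasurableSpace E] where
  K : ℕ
  copies : |(K : ℝ) - 2 * ε ^ (-(1 / 2) : ℝ)| < 1
  e : Fin (K + 1) → E
  orthonormal : Orthonormal ℝ e
  PS : Measure E
  PT : Measure E
  isProbS : IsProbabilityMeasure PS
  isProbT : IsProbabilityMeasure PT
  fourthMomentS : Integrable (fun x => ‖x‖ ^ 4) PS
  fourthMomentT : Integrable (fun x => ‖x‖ ^ 4) PT
  secondMomentS : HasSecondMoment PS (diagOp e (sourceSpectrum ε K))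
  secondMomentT : HasSecondMoment PT (diagOp e (targetSpectrum ε K))

namespace ShiftInstance

attribute [instance] ShiftInstance.isProbS ShiftInstance.isProbT

variable {ε : ℝ} (I : ShiftInstance ε E)

/-- The source covariance. -/
noncomputable def G : E →L[ℝ] E := diagOp I.e (sourceSpectrum ε I.K)

/-- The target covariance. -/
noncomputable def H : E →L[ℝ] E := diagOp I.e (targetSpectrum ε I.K)

noncomputable def traceG : ℝ := ∑ i, sourceSpectrum ε I.K i

noncomputable def traceH : ℝ := ∑ i, targetSpectrum ε I.K i

/-- `w* = (1, 1, 0, 0, …)`. -/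
noncomputable def wStar : E := I.e 0 + I.e 1

/-- The target domain excess risk. -/
noncomputable def excessRisk (w : E) : ℝ :=
  risk (dataLaw I.PT I.wStar) w - risk (dataLaw I.PT I.wStar) I.wStar

/-- The fourth moment condition with constant `α`, for source and target. -/
def FourthMoment (α : ℝ) : Prop :=
  FourthMomentUpper α I.PS I.e (sourceSpectrum ε I.K) ∧
    FourthMomentUpper α I.PT I.e (targetSpectrum ε I.K)

/-- The excess risk of the output `w_{M+N}` of SGD run on the data sequence `z`. -/
noncomputable def outputRisk (γ₀ γM : ℝ) (M N : ℕ) (z : ℕ → E × ℝ) : ℝ :=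
  I.excessRisk (sgd (stepSize γ₀ γM M N) z (M + N))

variable [BorelSpace E] [SecondCountableTopology E]

/-- The joint law of the independent data: `M` source data followed by target data (of which
SGD uses the first `N`). -/
noncomputable def dataMeasure (M : ℕ) : Measure (ℕ → E × ℝ) :=
  Measure.infinitePi (datumLaw I.PS I.PT I.wStar M)

/-- The expected excess risk of `w_{M+N}`. -/
noncomputable def expectedRisk (γ₀ γM : ℝ) (M N : ℕ) : ℝ :=
  ∫ z, I.outputRisk γ₀ γM M N z ∂(I.dataMeasure M)

end ShiftInstance

end Definitions

/-! The whole argument runs on the mean square errors `v i t` of the iterates along the coordinates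
`e i`. The target excess risk is half the sum of these errors weighted by the target spectrum
(`expectedRisk_eq`). Since each datum is independent of the current iterate, `v i` obeys an exact
one-step identity (`directionalError_succ`) in which only a fourth moment of the covariate is not
explicit. Jensen's inequality bounds that term below (`le_directionalError_succ`). The fourth moment
condition bounds it above and couples the coordinates only through the weighted total error
(`directionalError_succ_le`).

Supervised lower bound: put `r = ε^{1/2}` and let `p` be the product of the factors `1 - γ_t r`. The
signal in coordinate 1 leaves an error of at least `p²`, so small risk forces `p ≤ 1/2`. By
Cauchy–Schwarz (`one_sub_prod_sq_le_of_recursion`) each of the roughly `2/r` weak coordinates then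
collects weighted noise at least `(1-p)²/N ≥ 1/(4N)`, whatever the stepsizes. The total is of order
`1/(rN)`, and it must be below `2ε`.

Pretraining lower bound: the source sees coordinate 0 with variance only `ε²`, and stepsizes are at
most 1. With fewer than order `ε⁻²` steps, Bernoulli's inequality shows that a constant part of the
signal there is never learned.

Pretraining–finetuning: all errors stay at most 1 (`coordError_le_one`), which decouples the
coordinates at noise level `C = 1 + 4α`. Pretraining learns coordinate 1 up to `r/20`
(`coordError_one_le`) and adds nothing in the coordinates it cannot see. Finetuning uses stepsizes
of order `ε`, so the noise summed over the weak coordinates is of order `N ε²`, that is `ε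
log²(1/ε)`, much less than `r` (`sum_coordError_succ_le`). Meanwhile the leading coordinate has
variance 1 and contracts fast: the first stage brings it to order `ε`, and a later stage of fixed
index lowers the constant (`coordError_zero_le`). -/

set_option linter.unusedSectionVars false

/-! ### Integrating out the Gaussian label noise. -/

section Noise

lemma integral_sq_gaussianReal_zero_one : ∫ ξ, ξ ^ 2 ∂gaussianReal 0 1 = 1 := by
  have h := variance_fun_id_gaussianReal (μ := 0) (v := 1)
  rw [variance_eq_integral (by fun_prop)] at h
  simpa [integral_id_gaussianReal] using h

lemma integrable_id_gaussianReal_zero_one : Integrable (fun ξ : ℝ => ξ) (gaussianReal 0 1) :=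
  (memLp_id_gaussianReal 1).integrable (by norm_num)

lemma integrable_sq_gaussianReal_zero_one :
    Integrable (fun ξ : ℝ => ξ ^ 2) (gaussianReal 0 1) :=
  (memLp_id_gaussianReal 2).integrable_sq

variable {X : Type*} [MeasurableSpace X] {P : Measure X} [IsProbabilityMeasure P]
  {g₀ g₁ g₂ : X → ℝ}

lemma integrable_quadratic_noise (h₀ : Integrable g₀ P) (h₁ : Integrable g₁ P)
    (h₂ : Integrable g₂ P) :
    Integrable (fun p : X × ℝ => g₀ p.1 + g₁ p.1 * p.2 + g₂ p.1 * p.2 ^ 2)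
      (P.prod (gaussianReal 0 1)) :=
  ((h₀.comp_fst _).add (h₁.mul_prod integrable_id_gaussianReal_zero_one)).add
    (h₂.mul_prod integrable_sq_gaussianReal_zero_one)

/-- Centred noise of unit variance averages out of a quadratic polynomial. -/
lemma integral_quadratic_noise (h₀ : Integrable g₀ P) (h₁ : Integrable g₁ P)
    (h₂ : Integrable g₂ P) :
    ∫ p : X × ℝ, (g₀ p.1 + g₁ p.1 * p.2 + g₂ p.1 * p.2 ^ 2) ∂(P.prod (gaussianReal 0 1))
      = ∫ x, g₀ x ∂P + ∫ x, g₂ x ∂P := by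
  have e₀ := h₀.comp_fst (gaussianReal 0 1)
  have e₁ := h₁.mul_prod integrable_id_gaussianReal_zero_one
  have e₂ := h₂.mul_prod integrable_sq_gaussianReal_zero_one
  have e₀₁ : Integrable (fun p : X × ℝ => g₀ p.1 + g₁ p.1 * p.2) (P.prod (gaussianReal 0 1)) :=
    e₀.add e₁
  rw [integral_add e₀₁ e₂, integral_add e₀ e₁,
    integral_prod_mul g₁ (fun ξ : ℝ => ξ), integral_prod_mul g₂ (fun ξ : ℝ => ξ ^ 2),
    integral_id_gaussianReal, integral_sq_gaussianReal_zero_one, integral_fun_fst]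
  simp

end Noise

section OnlineRegression

variable {E : Type*} [NormedAddCommGroup E] [InnerProductSpace ℝ E] [MeasurableSpace E]
  [BorelSpace E] [SecondCountableTopology E]

/-! ### Consequences of finite fourth moments; one SGD step. -/

section Moments

variable {P : Measure E} [IsProbabilityMeasure P]

lemma integrable_of_abs_le_norm_pow_four (hP : Integrable (fun x => ‖x‖ ^ 4) P) {f : E → ℝ}
    (hf : Measurable f) (C : ℝ) (h : ∀ x, |f x| ≤ C * (1 + ‖x‖ ^ 4)) : Integrable f P :=
  (((integrable_const (1 : ℝ)).add hP).const_mul C).mono' hf.aestronglyMeasurable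
    (Filter.Eventually.of_forall h)

lemma integrable_inner_mul_inner (hP : Integrable (fun x => ‖x‖ ^ 4) P) (u v : E) :
    Integrable (fun x => inner ℝ u x * inner ℝ v x) P := by
  refine integrable_of_abs_le_norm_pow_four hP (by fun_prop) (‖u‖ * ‖v‖) fun x => ?_
  rw [abs_mul]
  calc |inner ℝ u x| * |inner ℝ v x| ≤ (‖u‖ * ‖x‖) * (‖v‖ * ‖x‖) := by
        gcongr <;> exact abs_real_inner_le_norm _ _
    _ = ‖u‖ * ‖v‖ * ‖x‖ ^ 2 := by ring
    _ ≤ ‖u‖ * ‖v‖ * (1 + ‖x‖ ^ 4) := by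
        gcongr
        nlinarith [sq_nonneg (‖x‖ ^ 2 - 1)]

lemma integrable_inner_sq_mul_inner_sq (hP : Integrable (fun x => ‖x‖ ^ 4) P) (u v : E) :
    Integrable (fun x => (inner ℝ u x * inner ℝ v x) ^ 2) P := by
  refine integrable_of_abs_le_norm_pow_four hP (by fun_prop) ((‖u‖ * ‖v‖) ^ 2) fun x => ?_
  rw [abs_pow, abs_mul]
  calc (|inner ℝ u x| * |inner ℝ v x|) ^ 2 ≤ ((‖u‖ * ‖x‖) * (‖v‖ * ‖x‖)) ^ 2 := by
        gcongr <;> exact abs_real_inner_le_norm _ _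
    _ = (‖u‖ * ‖v‖) ^ 2 * ‖x‖ ^ 4 := by ring
    _ ≤ (‖u‖ * ‖v‖) ^ 2 * (1 + ‖x‖ ^ 4) := by
        gcongr
        linarith

/-- The variance is nonnegative. This is the Jensen step behind both lower bounds, and it also
forces `α ≥ 1`. -/
lemma integral_sq_le_integral_of_sq {f : E → ℝ} (hf : Integrable f P)
    (hf2 : Integrable (fun x => f x ^ 2) P) : (∫ x, f x ∂P) ^ 2 ≤ ∫ x, f x ^ 2 ∂P := by
  set m := ∫ x, f x ∂P with hm
  have h : 0 ≤ ∫ x, (f x - m) ^ 2 ∂P := integral_nonneg fun x => sq_nonneg _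
  have e : ∫ x, (f x - m) ^ 2 ∂P = ∫ x, f x ^ 2 ∂P - m ^ 2 := by
    have : ∀ x, (f x - m) ^ 2 = f x ^ 2 - 2 * m * f x + m ^ 2 := fun x => by ring
    simp_rw [this]
    have hs : Integrable (fun x => f x ^ 2 - 2 * m * f x) P := hf2.sub (hf.const_mul _)
    rw [integral_add hs (integrable_const _), integral_sub hf2 (hf.const_mul _), integral_const_mul, ← hm]
    simp
    ring
  linarith

/-- Pushing the noise variable into the regression model. -/
lemma measurable_regression (w : E) :
    Measurable (fun p : E × ℝ => (p.1, inner ℝ w p.1 + p.2)) := by fun_prop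

lemma integrable_dataLaw_iff (w : E) {f : E × ℝ → ℝ} (hf : Measurable f) :
    Integrable f (dataLaw P w) ↔
      Integrable (fun p : E × ℝ => f (p.1, inner ℝ w p.1 + p.2)) (P.prod (gaussianReal 0 1)) :=
  integrable_map_measure hf.aestronglyMeasurable (measurable_regression w).aemeasurable

lemma integral_dataLaw (w : E) {f : E × ℝ → ℝ} (hf : Measurable f) :
    ∫ p, f p ∂(dataLaw P w)
      = ∫ p : E × ℝ, f (p.1, inner ℝ w p.1 + p.2) ∂(P.prod (gaussianReal 0 1)) :=
  integral_map (measurable_regression w).aemeasurable hf.aestronglyMeasurable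

/-- The unit label noise contributes the same constant to both risks and cancels. -/
lemma risk_sub_risk (hP : Integrable (fun x => ‖x‖ ^ 4) P) {T : E →L[ℝ] E}
    (hT : HasSecondMoment P T) (w v : E) :
    risk (dataLaw P w) v - risk (dataLaw P w) w = 1 / 2 * inner ℝ (v - w) (T (v - w)) := by
  have key : ∀ v : E, risk (dataLaw P w) v = 1 / 2 * (inner ℝ (v - w) (T (v - w)) + 1) := by
    intro v
    have h1 : Integrable (fun x => -2 * inner ℝ (v - w) x) P := by
      refine integrable_of_abs_le_norm_pow_four hP (by fun_prop) (2 * ‖v - w‖) fun x => ?_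
      rw [abs_mul]
      have := abs_real_inner_le_norm (v - w) x
      have h4 : ‖x‖ ≤ 1 + ‖x‖ ^ 4 := by
        nlinarith [sq_nonneg (‖x‖ ^ 2 - 1), sq_nonneg (‖x‖ - 1), norm_nonneg x]
      calc |(-2 : ℝ)| * |inner ℝ (v - w) x| ≤ 2 * (‖v - w‖ * ‖x‖) := by
            norm_num; exact this
        _ ≤ 2 * (‖v - w‖ * (1 + ‖x‖ ^ 4)) := by gcongr
        _ = _ := by ring
    have := integral_quadratic_noise (integrable_inner_mul_inner hP (v - w) (v - w)) h1
      (integrable_const (1 : ℝ))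
    rw [hT] at this
    unfold risk
    rw [integral_dataLaw w (by fun_prop)]
    congr 1
    rw [integral_const] at this
    simp only [probReal_univ, smul_eq_mul, mul_one] at this
    rw [← this]
    refine integral_congr_ae (Filter.Eventually.of_forall fun p => ?_)
    simp only [inner_sub_left]
    ring
  rw [key v, key w]
  simp
  ring

/-- One step of SGD, seen in the direction `u`. -/
lemma integral_sgdStep (hP : Integrable (fun x => ‖x‖ ^ 4) P) {T : E →L[ℝ] E}
    (hT : HasSecondMoment P T) (w u v : E) (γ : ℝ) :
    ∫ p, inner ℝ u (v - γ • (inner ℝ p.1 v • p.1 - p.2 • p.1) - w) ^ 2 ∂(dataLaw P w)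
      = inner ℝ u (v - w) ^ 2 - 2 * γ * inner ℝ u (v - w) * inner ℝ u (T (v - w))
        + γ ^ 2 * ∫ x, (inner ℝ u x * inner ℝ (v - w) x) ^ 2 ∂P + γ ^ 2 * inner ℝ u (T u) := by
  set a := inner ℝ u (v - w) with ha
  have i2 := integrable_inner_mul_inner hP u (v - w)
  have i4 := integrable_inner_sq_mul_inner_sq hP u (v - w)
  have iu := integrable_inner_mul_inner hP u u
  have h0 : Integrable (fun x => a ^ 2 - 2 * γ * a * (inner ℝ u x * inner ℝ (v - w) x)
      + γ ^ 2 * (inner ℝ u x * inner ℝ (v - w) x) ^ 2) P :=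
    ((integrable_const _).sub (i2.const_mul _)).add (i4.const_mul _)
  -- This is the coefficient of the noise to the first power. It is cubic in `x`, and only its
  -- integrability matters because the noise is centred.
  have h1 : Integrable (fun x => 2 * γ * inner ℝ u x *
      (a - γ * (inner ℝ u x * inner ℝ (v - w) x))) P := by
    have hx : ∀ x : E, ‖x‖ ≤ 1 + ‖x‖ ^ 4 ∧ ‖x‖ ^ 3 ≤ 1 + ‖x‖ ^ 4 := fun x => by
      have := norm_nonneg x
      constructor
      · nlinarith [sq_nonneg (‖x‖ ^ 2 - 1), sq_nonneg (‖x‖ - 1)]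
      · nlinarith [sq_nonneg (‖x‖ ^ 2 - ‖x‖), sq_nonneg (‖x‖ ^ 2 - 1), sq_nonneg (‖x‖ - 1),
          sq_nonneg ‖x‖]
    refine integrable_of_abs_le_norm_pow_four hP (by fun_prop)
      (2 * |γ| * ‖u‖ * (|a| + |γ| * (‖u‖ * ‖v - w‖))) fun x => ?_
    have e1 := abs_real_inner_le_norm u x
    have e2 := abs_real_inner_le_norm (v - w) x
    calc |2 * γ * inner ℝ u x * (a - γ * (inner ℝ u x * inner ℝ (v - w) x))|
        = 2 * |γ| * |inner ℝ u x| * |a - γ * (inner ℝ u x * inner ℝ (v - w) x)| := by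
          simp [abs_mul]
      _ ≤ 2 * |γ| * |inner ℝ u x| * (|a| + |γ| * (|inner ℝ u x| * |inner ℝ (v - w) x|)) := by
          gcongr
          refine (abs_sub _ _).trans ?_
          simp [abs_mul]
      _ ≤ 2 * |γ| * (‖u‖ * ‖x‖) * (|a| + |γ| * ((‖u‖ * ‖x‖) * (‖v - w‖ * ‖x‖))) := by
          gcongr
      _ = 2 * |γ| * ‖u‖ * (|a| * ‖x‖ + |γ| * (‖u‖ * ‖v - w‖) * ‖x‖ ^ 3) := by ring
      _ ≤ 2 * |γ| * ‖u‖ * (|a| * (1 + ‖x‖ ^ 4)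
            + |γ| * (‖u‖ * ‖v - w‖) * (1 + ‖x‖ ^ 4)) := by
          gcongr
          exacts [(hx x).1, (hx x).2]
      _ = _ := by ring
  have h2 := iu.const_mul (γ ^ 2)
  have := integral_quadratic_noise h0 h1 h2
  have h00 : Integrable (fun x => a ^ 2 - 2 * γ * a * (inner ℝ u x * inner ℝ (v - w) x)) P :=
    (integrable_const _).sub (i2.const_mul _)
  rw [integral_add h00 (i4.const_mul _),
    integral_sub (integrable_const _) (i2.const_mul _), integral_const_mul, integral_const_mul,
    integral_const_mul, hT, hT] at this
  simp only [integral_const, probReal_univ, smul_eq_mul, one_mul] at this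
  rw [integral_dataLaw w (by fun_prop), ← this]
  refine integral_congr_ae (Filter.Eventually.of_forall fun p => ?_)
  simp only [ha, inner_sub_left, inner_sub_right, inner_smul_right,
    real_inner_comm p.1 v, real_inner_comm p.1 w]
  ring

end Moments

/-! ### Independence of iterate and fresh datum; directional errors. -/

section Trajectory

lemma sgd_congr (γ : ℕ → ℝ) {z z' : ℕ → E × ℝ} :
    ∀ {t : ℕ}, (∀ s < t, z s = z' s) → sgd γ z t = sgd γ z' t
  | 0, _ => rfl
  | t + 1, h => by
    simp only [sgd, sgd_congr γ fun s hs => h s (hs.trans (Nat.lt_succ_self t)),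
      h t (Nat.lt_succ_self t)]

@[fun_prop]
lemma measurable_sgd (γ : ℕ → ℝ) (t : ℕ) : Measurable fun z : ℕ → E × ℝ => sgd γ z t := by
  induction t with
  | zero => exact measurable_const
  | succ t ih =>
    simp only [sgd]
    fun_prop

variable {D : ℕ → Measure (E × ℝ)} [∀ t, IsProbabilityMeasure (D t)]

lemma indepFun_sgd_eval (γ : ℕ → ℝ) (t : ℕ) :
    IndepFun (fun z : ℕ → E × ℝ => sgd γ z t) (fun z => z t) (Measure.infinitePi D) := by
  have h : iIndepFun (fun (i : ℕ) (z : ℕ → E × ℝ) => z i) (Measure.infinitePi D) :=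
    iIndepFun_infinitePi (X := fun _ p => p) (fun _ => measurable_id)
  have h2 := h.indepFun_finset (Finset.range t) {t} (by simp) (fun i => measurable_pi_apply i)
  -- Padding by zero makes the iterate a measurable function of the first `t` data alone. The
  -- padding value is irrelevant by `sgd_congr`.
  let ext : (Finset.range t → E × ℝ) → ℕ → E × ℝ :=
    fun r s => if hs : s ∈ Finset.range t then r ⟨s, hs⟩ else 0
  have hext : Measurable ext := by
    refine measurable_pi_lambda _ fun s => ?_
    by_cases hs : s ∈ Finset.range t
    · simpa only [ext, hs, dite_true] using measurable_pi_apply _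
    · simp only [ext, hs, dite_false]
      exact measurable_const
  have h3 := h2.comp ((measurable_sgd γ t).comp hext)
    (measurable_pi_apply (⟨t, by simp⟩ : ({t} : Finset ℕ)))
  have h4 : (fun z : ℕ → E × ℝ => sgd γ z t)
      = ((fun z => sgd γ z t) ∘ ext) ∘ fun z (i : Finset.range t) => z i := by
    funext z
    refine sgd_congr γ fun s hs => ?_
    simp [ext, hs]
  rw [h4]
  exact h3

lemma map_sgd_eval (γ : ℕ → ℝ) (t : ℕ) :
    (Measure.infinitePi D).map (fun z => (sgd γ z t, z t))
      = ((Measure.infinitePi D).map fun z => sgd γ z t).prod (D t) := by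
  rw [(indepFun_iff_map_prod_eq_prod_map_map (measurable_sgd γ t).aemeasurable
    (measurable_pi_apply t).aemeasurable).1 (indepFun_sgd_eval γ t),
    (measurePreserving_eval_infinitePi D t).map_eq]

variable {γ : ℕ → ℝ} {t : ℕ} {f : E × (E × ℝ) → ℝ}

/-- Conditioning on the past. -/
lemma integral_sgd_eval (hf : Measurable f)
    (hi : Integrable (fun z => f (sgd γ z t, z t)) (Measure.infinitePi D)) :
    Integrable (fun z => ∫ p, f (sgd γ z t, p) ∂(D t)) (Measure.infinitePi D) ∧
    ∫ z, f (sgd γ z t, z t) ∂(Measure.infinitePi D)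
      = ∫ z, (∫ p, f (sgd γ z t, p) ∂(D t)) ∂(Measure.infinitePi D) := by
  have hm : Measurable fun z : ℕ → E × ℝ => (sgd γ z t, z t) := by fun_prop
  have hi' : Integrable f (((Measure.infinitePi D).map fun z => sgd γ z t).prod (D t)) := by
    rw [← map_sgd_eval]
    exact (integrable_map_measure hf.aestronglyMeasurable hm.aemeasurable).2 hi
  have hl := hi'.integral_prod_left
  refine ⟨hl.comp_measurable (measurable_sgd γ t), ?_⟩
  rw [← integral_map (φ := fun z => (sgd γ z t, z t)) hm.aemeasurable hf.aestronglyMeasurable,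
    map_sgd_eval, integral_prod _ hi',
    integral_map (measurable_sgd γ t).aemeasurable hl.aestronglyMeasurable]

variable {P : ℕ → Measure E} [∀ t, IsProbabilityMeasure (P t)] {w : E}

lemma integrable_sq_label_mul_sq_norm (hD : D t = dataLaw (P t) w)
    (hP : Integrable (fun x => ‖x‖ ^ 4) (P t)) :
    Integrable (fun p : E × ℝ => p.2 ^ 2 * ‖p.1‖ ^ 2) (D t) := by
  rw [hD, integrable_dataLaw_iff w (by fun_prop)]
  have h2 : Integrable (fun x => ‖x‖ ^ 2) (P t) := by
    refine integrable_of_abs_le_norm_pow_four hP (by fun_prop) 1 fun x => ?_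
    rw [abs_of_nonneg (by positivity)]
    nlinarith [sq_nonneg (‖x‖ ^ 2 - 1)]
  have := (integrable_quadratic_noise (hP.const_mul (2 * ‖w‖ ^ 2))
    (integrable_const (0 : ℝ)) (h2.const_mul 2))
  refine this.mono' (by fun_prop) (Filter.Eventually.of_forall fun p => ?_)
  rw [Real.norm_of_nonneg (by positivity)]
  have h := abs_real_inner_le_norm w p.1
  have h' : inner ℝ w p.1 ^ 2 ≤ (‖w‖ * ‖p.1‖) ^ 2 := sq_le_sq' (abs_le.1 h).1 (abs_le.1 h).2
  have h'' : (inner ℝ w p.1 + p.2) ^ 2 ≤ 2 * (‖w‖ * ‖p.1‖) ^ 2 + 2 * p.2 ^ 2 := by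
    nlinarith [sq_nonneg (inner ℝ w p.1 - p.2)]
  calc (inner ℝ w p.1 + p.2) ^ 2 * ‖p.1‖ ^ 2
      ≤ (2 * (‖w‖ * ‖p.1‖) ^ 2 + 2 * p.2 ^ 2) * ‖p.1‖ ^ 2 := by gcongr
    _ = _ := by ring

/-- The bound is arranged as a function of the past times a function of the fresh datum, plus a
function of the fresh datum, so that independence gives integrability by induction. -/
lemma norm_sgd_succ_sq_le (γ : ℕ → ℝ) (z : ℕ → E × ℝ) (t : ℕ) :
    ‖sgd γ z (t + 1)‖ ^ 2 ≤ ‖sgd γ z t‖ ^ 2 * (2 * (1 + |γ t| * ‖(z t).1‖ ^ 2) ^ 2)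
      + 2 * γ t ^ 2 * ((z t).2 ^ 2 * ‖(z t).1‖ ^ 2) := by
  set v := sgd γ z t
  set x := (z t).1
  set y := (z t).2
  have h : ‖sgd γ z (t + 1)‖ ≤ ‖v‖ * (1 + |γ t| * ‖x‖ ^ 2) + |γ t| * (|y| * ‖x‖) := by
    calc ‖v - γ t • (inner ℝ x v • x - y • x)‖
        ≤ ‖v‖ + |γ t| * (|inner ℝ x v| * ‖x‖ + |y| * ‖x‖) := by
          refine (norm_sub_le _ _).trans ?_
          rw [norm_smul, Real.norm_eq_abs]
          gcongr
          refine (norm_sub_le _ _).trans ?_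
          rw [norm_smul, norm_smul, Real.norm_eq_abs, Real.norm_eq_abs]
      _ ≤ ‖v‖ + |γ t| * ((‖x‖ * ‖v‖) * ‖x‖ + |y| * ‖x‖) := by
          gcongr
          exact abs_real_inner_le_norm _ _
      _ = _ := by ring
  calc ‖sgd γ z (t + 1)‖ ^ 2
      ≤ (‖v‖ * (1 + |γ t| * ‖x‖ ^ 2) + |γ t| * (|y| * ‖x‖)) ^ 2 := by gcongr
    _ ≤ 2 * (‖v‖ * (1 + |γ t| * ‖x‖ ^ 2)) ^ 2 + 2 * (|γ t| * (|y| * ‖x‖)) ^ 2 := by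
        nlinarith [sq_nonneg (‖v‖ * (1 + |γ t| * ‖x‖ ^ 2) - |γ t| * (|y| * ‖x‖))]
    _ = _ := by
        rw [mul_pow (|γ t|), mul_pow (|y|), sq_abs, sq_abs]
        ring

lemma integrable_sq_norm_sgd (hD : ∀ t, D t = dataLaw (P t) w)
    (hP : ∀ t, Integrable (fun x => ‖x‖ ^ 4) (P t)) (γ : ℕ → ℝ) (t : ℕ) :
    Integrable (fun z => ‖sgd γ z t‖ ^ 2) (Measure.infinitePi D) := by
  induction t with
  | zero => simp [sgd]
  | succ t ih =>
    have hz := measurePreserving_eval_infinitePi D t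
    have h1 : Integrable (fun z : ℕ → E × ℝ => 2 * (1 + |γ t| * ‖(z t).1‖ ^ 2) ^ 2)
        (Measure.infinitePi D) := by
      have : Integrable (fun p : E × ℝ => 2 * (1 + |γ t| * ‖p.1‖ ^ 2) ^ 2) (D t) := by
        rw [hD, integrable_dataLaw_iff w (by fun_prop)]
        have : Integrable (fun x => 2 * (1 + |γ t| * ‖x‖ ^ 2) ^ 2) (P t) := by
          refine integrable_of_abs_le_norm_pow_four (hP t) (by fun_prop) (4 * (1 + |γ t| ^ 2))
            fun x => ?_
          rw [abs_of_nonneg (by positivity)]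
          nlinarith [sq_nonneg (1 - |γ t| * ‖x‖ ^ 2), sq_nonneg (|γ t|), sq_nonneg (‖x‖ ^ 2)]
        exact this.comp_fst _
      exact hz.integrable_comp_of_integrable this
    have h2 : Integrable (fun z : ℕ → E × ℝ => (z t).2 ^ 2 * ‖(z t).1‖ ^ 2)
        (Measure.infinitePi D) :=
      hz.integrable_comp_of_integrable (integrable_sq_label_mul_sq_norm (hD t) (hP t))
    -- Independence makes the product of two merely integrable functions integrable, so fourth
    -- moments of the covariates suffice at every `t`.
    have h3 : IndepFun (fun z => ‖sgd γ z t‖ ^ 2)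
        (fun z : ℕ → E × ℝ => 2 * (1 + |γ t| * ‖(z t).1‖ ^ 2) ^ 2) (Measure.infinitePi D) :=
      (indepFun_sgd_eval γ t).comp (φ := fun v => ‖v‖ ^ 2)
        (ψ := fun p : E × ℝ => 2 * (1 + |γ t| * ‖p.1‖ ^ 2) ^ 2) (by fun_prop) (by fun_prop)
    refine ((h3.integrable_mul ih h1).add (h2.const_mul (2 * γ t ^ 2))).mono'
      (by fun_prop) (Filter.Eventually.of_forall fun z => ?_)
    rw [Real.norm_of_nonneg (by positivity)]
    exact norm_sgd_succ_sq_le γ z t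

/-- The mean square error of the `t`-th iterate in the direction `u`. -/
noncomputable def directionalError (D : ℕ → Measure (E × ℝ)) [∀ t, IsProbabilityMeasure (D t)]
    (γ : ℕ → ℝ) (w u : E) (t : ℕ) : ℝ :=
  ∫ z, inner ℝ u (sgd γ z t - w) ^ 2 ∂(Measure.infinitePi D)

lemma directionalError_nonneg (u : E) : 0 ≤ directionalError D γ w u t :=
  integral_nonneg fun _ => sq_nonneg _

lemma directionalError_zero (u : E) : directionalError D γ w u 0 = inner ℝ u w ^ 2 := by
  simp [directionalError, sgd]

lemma integrable_directionalError (hD : ∀ t, D t = dataLaw (P t) w)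
    (hP : ∀ t, Integrable (fun x => ‖x‖ ^ 4) (P t)) (u : E) :
    Integrable (fun z => inner ℝ u (sgd γ z t - w) ^ 2) (Measure.infinitePi D) := by
  refine (((integrable_sq_norm_sgd hD hP γ t).add (integrable_const (‖w‖ ^ 2))).const_mul
    (2 * ‖u‖ ^ 2)).mono' (by fun_prop) (Filter.Eventually.of_forall fun z => ?_)
  rw [Real.norm_of_nonneg (by positivity)]
  have h := abs_real_inner_le_norm u (sgd γ z t - w)
  have h' := norm_sub_le (sgd γ z t) w
  calc inner ℝ u (sgd γ z t - w) ^ 2 ≤ (‖u‖ * (‖sgd γ z t‖ + ‖w‖)) ^ 2 := by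
        rw [← sq_abs]
        gcongr
        exact h.trans (by gcongr)
    _ ≤ 2 * ‖u‖ ^ 2 * (‖sgd γ z t‖ ^ 2 + ‖w‖ ^ 2) := by
        have : 0 ≤ ‖u‖ ^ 2 * (‖sgd γ z t‖ - ‖w‖) ^ 2 := by positivity
        nlinarith

/-- The exact one step recursion. -/
lemma directionalError_succ (hD : ∀ t, D t = dataLaw (P t) w)
    (hP : ∀ t, Integrable (fun x => ‖x‖ ^ 4) (P t)) {T : E →L[ℝ] E}
    (hT : HasSecondMoment (P t) T) (u : E) :
    Integrable (fun z => inner ℝ u (sgd γ z t - w) ^ 2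
        - 2 * γ t * inner ℝ u (sgd γ z t - w) * inner ℝ u (T (sgd γ z t - w))
        + γ t ^ 2 * ∫ x, (inner ℝ u x * inner ℝ (sgd γ z t - w) x) ^ 2 ∂(P t)
        + γ t ^ 2 * inner ℝ u (T u)) (Measure.infinitePi D) ∧
    directionalError D γ w u (t + 1) = ∫ z, (inner ℝ u (sgd γ z t - w) ^ 2
        - 2 * γ t * inner ℝ u (sgd γ z t - w) * inner ℝ u (T (sgd γ z t - w))
        + γ t ^ 2 * ∫ x, (inner ℝ u x * inner ℝ (sgd γ z t - w) x) ^ 2 ∂(P t)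
        + γ t ^ 2 * inner ℝ u (T u)) ∂(Measure.infinitePi D) := by
  have h := integral_sgd_eval (D := D) (γ := γ) (t := t)
    (f := fun q => inner ℝ u (q.1 - γ t • (inner ℝ q.2.1 q.1 • q.2.1 - q.2.2 • q.2.1) - w) ^ 2)
    (by fun_prop) (integrable_directionalError (t := t + 1) hD hP u)
  simp only [hD t, integral_sgdStep (hP t) hT] at h
  exact h

/-! ### Two-sided recursions when the covariance is diagonal. -/

section Diagonal

variable {n : ℕ} {e : Fin n → E} {s : Fin n → ℝ}

lemma inner_diagOp (u v : E) (s : Fin n → ℝ) :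
    inner ℝ u (diagOp e s v) = ∑ i, s i * (inner ℝ (e i) v * inner ℝ (e i) u) := by
  simp [diagOp, inner_sum, inner_smul_right, real_inner_comm]

lemma inner_diagOp_self (v : E) :
    inner ℝ v (diagOp e s v) = ∑ i, s i * inner ℝ (e i) v ^ 2 := by
  simp [inner_diagOp, sq]

lemma inner_basis_diagOp (he : Orthonormal ℝ e) (i : Fin n) (v : E) :
    inner ℝ (e i) (diagOp e s v) = s i * inner ℝ (e i) v := by
  rw [inner_diagOp, Finset.sum_eq_single i]
  · simp [he.1 i]
  · intro j _ hj
    rw [he.2 hj]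
    simp
  · simp

lemma traceDiagMul_rankOne (he : Orthonormal ℝ e) (i : Fin n) :
    traceDiagMul e s (InnerProductSpace.rankOne ℝ (e i) (e i)) = s i := by
  unfold traceDiagMul
  rw [Finset.sum_eq_single i]
  · simp [he.1 i]
  · intro j _ hj
    simp [he.2 hj.symm]
  · simp

/-- The fourth moment condition is tested on the projection onto `e i`, whose trace against the
covariance is `s i`. -/
lemma integral_inner_sq_mul_inner_sq_le [CompleteSpace E] {Q : Measure E} {α : ℝ}
    (he : Orthonormal ℝ e) (h : FourthMomentUpper α Q e s) (i : Fin n) (v : E) :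
    ∫ x, (inner ℝ (e i) x * inner ℝ v x) ^ 2 ∂Q
      ≤ α * s i * ∑ j, s j * inner ℝ (e j) v ^ 2 := by
  have := h _ (InnerProductSpace.isPositive_rankOne_self (e i)) v
  rw [traceDiagMul_rankOne he, inner_diagOp_self] at this
  refine le_trans (le_of_eq ?_) this
  refine integral_congr_ae (Filter.Eventually.of_forall fun x => ?_)
  simp only [InnerProductSpace.rankOne_apply, inner_smul_right, real_inner_comm x (e i)]
  ring

/-- Jensen bounds the fourth moment term below by `s i ^ 2` times the squared error, which completes
the square to `(1 - γ t * s i) ^ 2`. -/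
lemma le_directionalError_succ (hD : ∀ t, D t = dataLaw (P t) w)
    (hP : ∀ t, Integrable (fun x => ‖x‖ ^ 4) (P t)) (he : Orthonormal ℝ e)
    (hT : HasSecondMoment (P t) (diagOp e s)) (i : Fin n) :
    (1 - γ t * s i) ^ 2 * directionalError D γ w (e i) t + γ t ^ 2 * s i
      ≤ directionalError D γ w (e i) (t + 1) := by
  obtain ⟨hi, h⟩ := directionalError_succ hD hP hT (e i) (γ := γ)
  have hd := integrable_directionalError hD hP (e i) (γ := γ) (t := t)
  have : (1 - γ t * s i) ^ 2 * directionalError D γ w (e i) t + γ t ^ 2 * s i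
      = ∫ z, ((1 - γ t * s i) ^ 2 * inner ℝ (e i) (sgd γ z t - w) ^ 2 + γ t ^ 2 * s i)
        ∂(Measure.infinitePi D) := by
    rw [integral_add (hd.const_mul _) (integrable_const _), integral_const_mul]
    simp [directionalError]
  rw [this, h]
  refine integral_mono ((hd.const_mul _).add (integrable_const _)) hi fun z => ?_
  have hj := integral_sq_le_integral_of_sq (integrable_inner_mul_inner (hP t) (e i) (sgd γ z t - w))
    (integrable_inner_sq_mul_inner_sq (hP t) (e i) (sgd γ z t - w))
  rw [hT] at hj
  simp only [inner_basis_diagOp he] at hj ⊢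
  have h1 : inner ℝ (e i) (e i) = (1 : ℝ) := by simp [he.1 i]
  rw [h1]
  have := mul_le_mul_of_nonneg_left hj (sq_nonneg (γ t))
  nlinarith

lemma directionalError_succ_le [CompleteSpace E] (hD : ∀ t, D t = dataLaw (P t) w)
    (hP : ∀ t, Integrable (fun x => ‖x‖ ^ 4) (P t)) (he : Orthonormal ℝ e)
    (hT : HasSecondMoment (P t) (diagOp e s)) {α : ℝ} (hα : FourthMomentUpper α (P t) e s)
    (i : Fin n) :
    directionalError D γ w (e i) (t + 1) ≤ (1 - 2 * γ t * s i) * directionalError D γ w (e i) t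
      + γ t ^ 2 * s i * (1 + α * ∑ j, s j * directionalError D γ w (e j) t) := by
  obtain ⟨hi, h⟩ := directionalError_succ hD hP hT (e i) (γ := γ)
  have hd := fun j => integrable_directionalError hD hP (e j) (γ := γ) (t := t)
  have hs : Integrable (fun z => ∑ j, s j * inner ℝ (e j) (sgd γ z t - w) ^ 2)
      (Measure.infinitePi D) := integrable_finsetSum _ fun j _ => (hd j).const_mul _
  have hs' : Integrable (fun z => 1 + α * ∑ j, s j * inner ℝ (e j) (sgd γ z t - w) ^ 2)
      (Measure.infinitePi D) := (integrable_const (1 : ℝ)).add (hs.const_mul α)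
  have : (1 - 2 * γ t * s i) * directionalError D γ w (e i) t
      + γ t ^ 2 * s i * (1 + α * ∑ j, s j * directionalError D γ w (e j) t)
      = ∫ z, ((1 - 2 * γ t * s i) * inner ℝ (e i) (sgd γ z t - w) ^ 2
        + γ t ^ 2 * s i * (1 + α * ∑ j, s j * inner ℝ (e j) (sgd γ z t - w) ^ 2))
        ∂(Measure.infinitePi D) := by
    rw [integral_add ((hd i).const_mul _) (hs'.const_mul _),
      integral_const_mul, integral_const_mul, integral_add (integrable_const _) (hs.const_mul α),
      integral_const_mul, integral_finsetSum _ fun j _ => (hd j).const_mul _]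
    simp [directionalError, integral_const_mul]
  rw [this, h]
  refine integral_mono hi (((hd i).const_mul _).add (hs'.const_mul _)) fun z => ?_
  have hj := integral_inner_sq_mul_inner_sq_le he hα i (sgd γ z t - w)
  have h1 : inner ℝ (e i) (e i) = (1 : ℝ) := by simp [he.1 i]
  simp only [inner_basis_diagOp he, h1]
  have := mul_le_mul_of_nonneg_left hj (sq_nonneg (γ t))
  nlinarith

/-- A fourth moment bound along a direction of unit variance has constant at least one. -/
lemma one_le_of_fourthMomentUpper [CompleteSpace E] {Q : Measure E} [IsProbabilityMeasure Q]
    (hQ : Integrable (fun x => ‖x‖ ^ 4) Q) (he : Orthonormal ℝ e)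
    (hT : HasSecondMoment Q (diagOp e s)) {α : ℝ} (hα : FourthMomentUpper α Q e s) {i : Fin n}
    (hi : s i = 1) : 1 ≤ α := by
  have h1 : inner ℝ (e i) (e i) = (1 : ℝ) := by simp [he.1 i]
  have hj := integral_sq_le_integral_of_sq (integrable_inner_mul_inner hQ (e i) (e i))
    (integrable_inner_sq_mul_inner_sq hQ (e i) (e i))
  rw [hT, inner_basis_diagOp he, hi, h1] at hj
  have := integral_inner_sq_mul_inner_sq_le he hα i (e i)
  rw [← inner_diagOp_self, inner_basis_diagOp he, hi, h1] at this
  linarith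

end Diagonal

end Trajectory

end OnlineRegression

/-! ### Scalar recursions: surviving bias and accumulated noise. -/

section ScalarLowerBounds

variable {v g : ℕ → ℝ} {s : ℝ} {n : ℕ}

lemma mul_prod_sq_le_of_recursion
    (h : ∀ t < n, (1 - g t * s) ^ 2 * v t + g t ^ 2 * s ≤ v (t + 1)) (hs : 0 ≤ s) :
    v 0 * (∏ t ∈ Finset.range n, (1 - g t * s)) ^ 2 ≤ v n := by
  induction n with
  | zero => simp
  | succ n ih =>
    have h1 := ih fun t ht => h t (ht.trans (Nat.lt_succ_self n))
    have h2 := h n (Nat.lt_succ_self n)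
    have h3 := mul_le_mul_of_nonneg_left h1 (sq_nonneg (1 - g n * s))
    have h4 : 0 ≤ g n ^ 2 * s := by positivity
    rw [Finset.prod_range_succ]
    nlinarith

/-- The noise accumulated by SGD, bounded below by the Cauchy–Schwarz inequality. -/
lemma one_sub_prod_sq_le_of_recursion
    (h : ∀ t < n, (1 - g t * s) ^ 2 * v t + g t ^ 2 * s ≤ v (t + 1)) (hs : 0 ≤ s)
    (hv : 0 ≤ v 0) :
    (1 - ∏ t ∈ Finset.range n, (1 - g t * s)) ^ 2 ≤ n * (s * v n) := by
  induction n with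
  | zero => simp
  | succ n ih =>
    have h1 := ih fun t ht => h t (ht.trans (Nat.lt_succ_self n))
    have h2 := h n (Nat.lt_succ_self n)
    rw [Finset.prod_range_succ]
    set B := 1 - ∏ t ∈ Finset.range n, (1 - g t * s) with hB
    set x := g n * s with hx
    have e1 : 1 - (∏ t ∈ Finset.range n, (1 - g t * s)) * (1 - x) = (1 - x) * B + x := by
      rw [hB]; ring
    rw [e1]
    have h3 : (1 - x) ^ 2 * (s * v n) + x ^ 2 ≤ s * v (n + 1) := by
      have := mul_le_mul_of_nonneg_left h2 hs
      calc _ = s * ((1 - x) ^ 2 * v n + g n ^ 2 * s) := by rw [hx]; ring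
        _ ≤ _ := this
    have h4 : ((1 - x) * B) ^ 2 ≤ n * ((1 - x) ^ 2 * (s * v n)) := by
      have := mul_le_mul_of_nonneg_left h1 (sq_nonneg (1 - x))
      linarith [mul_pow (1 - x) B 2]
    set p := (1 - x) * B
    set Q := (1 - x) ^ 2 * (s * v n)
    -- Cauchy–Schwarz with one more term, from `2px ≤ p²/n + n x²` and `p² ≤ nQ`. The weight `1/n`
    -- is why `n = 0` is treated separately.
    have h5 : (p + x) ^ 2 ≤ ((n : ℝ) + 1) * (Q + x ^ 2) := by
      rcases Nat.eq_zero_or_pos n with rfl | hn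
      · have hp : p = 0 := by simpa [B] using h4
        have hQ : 0 ≤ Q := by positivity
        rw [hp]
        simpa using hQ
      · have hn' : (0 : ℝ) < n := by exact_mod_cast hn
        have : 2 * p * x ≤ Q + n * x ^ 2 := by
          have : (n : ℝ) * (2 * p * x) ≤ n * (Q + n * x ^ 2) := by
            nlinarith [sq_nonneg (p - n * x)]
          exact le_of_mul_le_mul_left this hn'
        nlinarith
    refine h5.trans ?_
    push_cast
    gcongr

end ScalarLowerBounds

/-! ### Elementary facts on the stepsizes. -/

section StepSize

lemma stepSize_source {γ₀ γM : ℝ} {M N t : ℕ} (ht : t < M) :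
    stepSize γ₀ γM M N t = γ₀ / 2 ^ ⌊(t : ℝ) / (M / Real.log M)⌋₊ := if_pos ht

lemma stepSize_target {γ₀ γM : ℝ} {M N t : ℕ} (ht : M ≤ t) :
    stepSize γ₀ γM M N t = γM / 2 ^ ⌊((t : ℝ) - M) / (N / Real.log N)⌋₊ := if_neg ht.not_gt

lemma div_two_pow_nonneg {γ : ℝ} (h : 0 ≤ γ) (k : ℕ) : 0 ≤ γ / 2 ^ k := by positivity

lemma div_two_pow_le {γ : ℝ} (h : 0 ≤ γ) (k : ℕ) : γ / 2 ^ k ≤ γ :=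
  div_le_self h (one_le_pow₀ (by norm_num))

end StepSize

/-! ### The concrete instance: spectra, traces, coordinate errors and the lower bounds. -/

namespace ShiftInstance

universe u

variable {E : Type u} [NormedAddCommGroup E] [InnerProductSpace ℝ E] [MeasurableSpace E]
  {ε : ℝ} (I : ShiftInstance ε E)

lemma two_le_K (h0 : 0 < ε) (h1 : ε < 1) : 2 ≤ I.K := by
  have h := (abs_lt.1 I.copies).1
  have : 1 ≤ ε ^ (-(1 / 2) : ℝ) :=
    Real.one_le_rpow_of_pos_of_le_one_of_nonpos h0 h1.le (by norm_num)
  have : (1 : ℝ) < I.K := by linarith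
  exact_mod_cast this

lemma one_ne_zero_index (h0 : 0 < ε) (h1 : ε < 1) : (1 : Fin (I.K + 1)) ≠ 0 := by
  have := I.two_le_K h0 h1
  intro h
  have := congrArg Fin.val h
  rw [Fin.val_one', Nat.mod_eq_of_lt (by omega)] at this
  simp at this

lemma rpow_half_sq (h0 : 0 < ε) : (ε ^ (1 / 2 : ℝ)) ^ 2 = ε := by
  rw [← Real.rpow_natCast, ← Real.rpow_mul h0.le]
  norm_num

lemma rpow_neg_half (h0 : 0 < ε) : ε ^ (-(1 / 2) : ℝ) = (ε ^ (1 / 2 : ℝ))⁻¹ :=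
  Real.rpow_neg h0.le _

/-- Rounding loses less than 1, and `ε^{-1/2} ≥ 1` absorbs it out of `2 ε^{-1/2}`. -/
lemma inv_le_K (h0 : 0 < ε) (h1 : ε < 1) : (ε ^ (1 / 2 : ℝ))⁻¹ ≤ I.K := by
  have h := (abs_lt.1 I.copies).1
  have : 1 ≤ ε ^ (-(1 / 2) : ℝ) :=
    Real.one_le_rpow_of_pos_of_le_one_of_nonpos h0 h1.le (by norm_num)
  rw [← rpow_neg_half h0]
  linarith

lemma K_mul_le (h0 : 0 < ε) (h1 : ε < 1) : I.K * ε ^ (1 / 2 : ℝ) ≤ 3 := by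
  have h := (abs_lt.1 I.copies).2
  rw [rpow_neg_half h0] at h
  have hr : 0 < ε ^ (1 / 2 : ℝ) := by positivity
  have hr1 : ε ^ (1 / 2 : ℝ) ≤ 1 := Real.rpow_le_one h0.le h1.le (by norm_num)
  have := mul_lt_mul_of_pos_right h hr
  have h3 : (ε ^ (1 / 2 : ℝ))⁻¹ * ε ^ (1 / 2 : ℝ) = 1 := inv_mul_cancel₀ hr.ne'
  nlinarith

lemma targetSpectrum_nonneg (h0 : 0 < ε) (K : ℕ) (i : Fin (K + 1)) :
    0 ≤ targetSpectrum ε K i := by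
  unfold targetSpectrum
  split_ifs <;> positivity

lemma targetSpectrum_zero (K : ℕ) : targetSpectrum ε K 0 = 1 := if_pos rfl

lemma targetSpectrum_of_ne_zero {K : ℕ} {i : Fin (K + 1)} (h : i ≠ 0) :
    targetSpectrum ε K i = ε ^ (1 / 2 : ℝ) := if_neg h

lemma targetSpectrum_le_one (h0 : 0 < ε) (h1 : ε < 1) (K : ℕ) (i : Fin (K + 1)) :
    targetSpectrum ε K i ≤ 1 := by
  unfold targetSpectrum
  split_ifs
  exacts [le_rfl, Real.rpow_le_one h0.le h1.le (by norm_num)]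

lemma sourceSpectrum_nonneg (K : ℕ) (i : Fin (K + 1)) : 0 ≤ sourceSpectrum ε K i := by
  unfold sourceSpectrum
  split_ifs <;> positivity

lemma sourceSpectrum_le_one (h0 : 0 < ε) (h1 : ε < 1) (K : ℕ) (i : Fin (K + 1)) :
    sourceSpectrum ε K i ≤ 1 := by
  unfold sourceSpectrum
  split_ifs
  · nlinarith
  · exact le_rfl
  · exact zero_le_one

lemma sourceSpectrum_zero (K : ℕ) : sourceSpectrum ε K 0 = ε ^ 2 := if_pos rfl

lemma sum_targetSpectrum_mul {K : ℕ} (f : Fin (K + 1) → ℝ) :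
    ∑ i, targetSpectrum ε K i * f i = f 0 + ε ^ (1 / 2 : ℝ) * ∑ i : Fin K, f i.succ := by
  rw [Fin.sum_univ_succ, Finset.mul_sum]
  simp [targetSpectrum, Fin.succ_ne_zero]

lemma sourceSpectrum_one (h0 : 0 < ε) (h1 : ε < 1) : sourceSpectrum ε I.K 1 = 1 := by
  simp [sourceSpectrum, I.one_ne_zero_index h0 h1]

lemma sourceSpectrum_of_ne {K : ℕ} {i : Fin (K + 1)} (h : i ≠ 0) (h' : i ≠ 1) :
    sourceSpectrum ε K i = 0 := by
  simp [sourceSpectrum, h, h']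

lemma sum_sourceSpectrum_mul (h0 : 0 < ε) (h1 : ε < 1) (f : Fin (I.K + 1) → ℝ) :
    ∑ i, sourceSpectrum ε I.K i * f i = ε ^ 2 * f 0 + f 1 := by
  have hne := I.one_ne_zero_index h0 h1
  rw [Finset.sum_eq_add_of_mem 0 1 (Finset.mem_univ _) (Finset.mem_univ _) hne.symm,
    sourceSpectrum_zero, I.sourceSpectrum_one h0 h1, one_mul]
  rintro i - ⟨hi0, hi1⟩
  rw [sourceSpectrum_of_ne hi0 hi1, zero_mul]

lemma traceH_eq : I.traceH = 1 + I.K * ε ^ (1 / 2 : ℝ) := by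
  have := sum_targetSpectrum_mul (ε := ε) (K := I.K) fun _ => 1
  simp only [mul_one] at this
  rw [traceH, this]
  simp [mul_comm]

lemma traceG_eq (h0 : 0 < ε) (h1 : ε < 1) : I.traceG = ε ^ 2 + 1 := by
  simpa [traceG] using I.sum_sourceSpectrum_mul h0 h1 fun _ => 1

lemma inner_e_wStar (h0 : 0 < ε) (h1 : ε < 1) (i : Fin (I.K + 1)) :
    inner ℝ (I.e i) I.wStar = if i = 0 ∨ i = 1 then 1 else (0 : ℝ) := by
  have hne := I.one_ne_zero_index h0 h1
  have ho := orthonormal_iff_ite.1 I.orthonormal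
  rw [wStar, inner_add_right, ho, ho]
  by_cases h : i = 0
  · simp [h, hne.symm]
  · simp [h]

lemma sq_inner_e_wStar_le_one (h0 : 0 < ε) (h1 : ε < 1) (i : Fin (I.K + 1)) :
    inner ℝ (I.e i) I.wStar ^ 2 ≤ 1 := by
  rw [I.inner_e_wStar h0 h1]
  split_ifs <;> simp

variable [BorelSpace E] [SecondCountableTopology E]

lemma normSqOp_G_wStar (h0 : 0 < ε) (h1 : ε < 1) : normSqOp I.G I.wStar = ε ^ 2 + 1 := by
  rw [normSqOp, G, inner_diagOp_self, I.sum_sourceSpectrum_mul h0 h1,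
    I.inner_e_wStar h0 h1, I.inner_e_wStar h0 h1]
  simp

lemma normSqOp_H_wStar (h0 : 0 < ε) (h1 : ε < 1) :
    normSqOp I.H I.wStar = 1 + ε ^ (1 / 2 : ℝ) := by
  have hne := I.one_ne_zero_index h0 h1
  rw [normSqOp, H, inner_diagOp_self,
    Finset.sum_eq_add_of_mem 0 1 (Finset.mem_univ _) (Finset.mem_univ _) hne.symm,
    targetSpectrum_zero, targetSpectrum_of_ne_zero hne, I.inner_e_wStar h0 h1,
    I.inner_e_wStar h0 h1]
  · simp
  · rintro i - ⟨hi0, hi1⟩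
    rw [I.inner_e_wStar h0 h1]
    simp [hi0, hi1]

/-- The law of the `t`-th covariate. -/
noncomputable def covariateLaw (M t : ℕ) : Measure E := if t < M then I.PS else I.PT

instance (M t : ℕ) : IsProbabilityMeasure (I.covariateLaw M t) := by
  unfold covariateLaw
  split_ifs <;> infer_instance

lemma covariateLaw_source {M t : ℕ} (h : t < M) : I.covariateLaw M t = I.PS := if_pos h

lemma covariateLaw_target {M t : ℕ} (h : M ≤ t) : I.covariateLaw M t = I.PT := if_neg h.not_gt

lemma datumLaw_eq (M t : ℕ) :
    datumLaw I.PS I.PT I.wStar M t = dataLaw (I.covariateLaw M t) I.wStar := by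
  unfold datumLaw covariateLaw
  split_ifs <;> rfl

lemma integrable_covariateLaw (M t : ℕ) :
    Integrable (fun x => ‖x‖ ^ 4) (I.covariateLaw M t) := by
  unfold covariateLaw
  split_ifs
  exacts [I.fourthMomentS, I.fourthMomentT]

/-- The mean square error of the `t`-th iterate along the `i`-th coordinate. -/
noncomputable def coordError (γ₀ γM : ℝ) (M N : ℕ) (i : Fin (I.K + 1)) (t : ℕ) : ℝ :=
  directionalError (datumLaw I.PS I.PT I.wStar M) (stepSize γ₀ γM M N) I.wStar (I.e i) t

variable {γ₀ γM : ℝ} {M N t : ℕ} {i : Fin (I.K + 1)}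

lemma coordError_nonneg : 0 ≤ I.coordError γ₀ γM M N i t := directionalError_nonneg _

lemma coordError_initial : I.coordError γ₀ γM M N i 0 = inner ℝ (I.e i) I.wStar ^ 2 :=
  directionalError_zero _

lemma outputRisk_eq (z : ℕ → E × ℝ) :
    I.outputRisk γ₀ γM M N z = 1 / 2 * ∑ i, targetSpectrum ε I.K i *
      inner ℝ (I.e i) (sgd (stepSize γ₀ γM M N) z (M + N) - I.wStar) ^ 2 := by
  rw [outputRisk, excessRisk, risk_sub_risk I.fourthMomentT I.secondMomentT, inner_diagOp_self]

lemma integrable_outputRisk : Integrable (I.outputRisk γ₀ γM M N) (I.dataMeasure M) := by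
  have : I.outputRisk γ₀ γM M N = fun z => 1 / 2 * ∑ i, targetSpectrum ε I.K i *
      inner ℝ (I.e i) (sgd (stepSize γ₀ γM M N) z (M + N) - I.wStar) ^ 2 :=
    funext I.outputRisk_eq
  rw [this]
  exact (integrable_finsetSum _ fun i _ => (integrable_directionalError (I.datumLaw_eq M)
    (I.integrable_covariateLaw M) (I.e i)).const_mul _).const_mul _

lemma expectedRisk_eq :
    I.expectedRisk γ₀ γM M N
      = 1 / 2 * ∑ i, targetSpectrum ε I.K i * I.coordError γ₀ γM M N i (M + N) := by
  simp only [expectedRisk, outputRisk_eq]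
  rw [integral_const_mul, dataMeasure, integral_finsetSum _ fun i _ =>
    (integrable_directionalError (I.datumLaw_eq M) (I.integrable_covariateLaw M)
      (I.e i)).const_mul _]
  simp_rw [integral_const_mul]
  rfl

lemma le_coordError_succ_source (ht : t < M) :
    (1 - stepSize γ₀ γM M N t * sourceSpectrum ε I.K i) ^ 2 * I.coordError γ₀ γM M N i t
      + stepSize γ₀ γM M N t ^ 2 * sourceSpectrum ε I.K i
        ≤ I.coordError γ₀ γM M N i (t + 1) :=
  le_directionalError_succ (I.datumLaw_eq M) (I.integrable_covariateLaw M) I.orthonormal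
    (by rw [I.covariateLaw_source ht]; exact I.secondMomentS) i

lemma le_coordError_succ_target (ht : M ≤ t) :
    (1 - stepSize γ₀ γM M N t * targetSpectrum ε I.K i) ^ 2 * I.coordError γ₀ γM M N i t
      + stepSize γ₀ γM M N t ^ 2 * targetSpectrum ε I.K i
        ≤ I.coordError γ₀ γM M N i (t + 1) :=
  le_directionalError_succ (I.datumLaw_eq M) (I.integrable_covariateLaw M) I.orthonormal
    (by rw [I.covariateLaw_target ht]; exact I.secondMomentT) i

lemma coordError_succ_le_source [CompleteSpace E] {α : ℝ} (hα : I.FourthMoment α) (ht : t < M) :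
    I.coordError γ₀ γM M N i (t + 1)
      ≤ (1 - 2 * stepSize γ₀ γM M N t * sourceSpectrum ε I.K i) * I.coordError γ₀ γM M N i t
        + stepSize γ₀ γM M N t ^ 2 * sourceSpectrum ε I.K i *
          (1 + α * ∑ j, sourceSpectrum ε I.K j * I.coordError γ₀ γM M N j t) :=
  directionalError_succ_le (I.datumLaw_eq M) (I.integrable_covariateLaw M) I.orthonormal
    (by rw [I.covariateLaw_source ht]; exact I.secondMomentS)
    (by rw [I.covariateLaw_source ht]; exact hα.1) i

lemma coordError_succ_le_target [CompleteSpace E] {α : ℝ} (hα : I.FourthMoment α) (ht : M ≤ t) :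
    I.coordError γ₀ γM M N i (t + 1)
      ≤ (1 - 2 * stepSize γ₀ γM M N t * targetSpectrum ε I.K i) * I.coordError γ₀ γM M N i t
        + stepSize γ₀ γM M N t ^ 2 * targetSpectrum ε I.K i *
          (1 + α * ∑ j, targetSpectrum ε I.K j * I.coordError γ₀ γM M N j t) :=
  directionalError_succ_le (I.datumLaw_eq M) (I.integrable_covariateLaw M) I.orthonormal
    (by rw [I.covariateLaw_target ht]; exact I.secondMomentT)
    (by rw [I.covariateLaw_target ht]; exact hα.2) i

lemma one_le_of_fourthMoment [CompleteSpace E] {α : ℝ} (hα : I.FourthMoment α) : 1 ≤ α :=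
  one_le_of_fourthMomentUpper I.fourthMomentT I.orthonormal I.secondMomentT hα.2
    (targetSpectrum_zero I.K)

/-- Supervised learning needs order `ε ^ (-3/2)` target data. -/
lemma supervised_lower_bound (h0 : 0 < ε) (h1 : ε < 1 / 64) {γ : ℝ}
    (hrisk : I.expectedRisk γ γ 0 N < ε) : 1 / 8 * ε ^ (-(3 / 2) : ℝ) ≤ N := by
  have h1' : ε < 1 := by linarith
  set r := ε ^ (1 / 2 : ℝ) with hr
  have hr0 : 0 < r := by positivity
  have hr2 : r ^ 2 = ε := rpow_half_sq h0
  have hr8 : r < 1 / 8 := by nlinarith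
  set g := stepSize γ γ 0 N
  set v := I.coordError γ γ 0 N
  set p := ∏ t ∈ Finset.range N, (1 - g t * r) with hp
  have hne := I.one_ne_zero_index h0 h1'
  rw [expectedRisk_eq, sum_targetSpectrum_mul, zero_add] at hrisk
  have hrec : ∀ i, i ≠ 0 → ∀ t < N, (1 - g t * r) ^ 2 * v i t + g t ^ 2 * r ≤ v i (t + 1) := by
    intro i hi t _
    have := I.le_coordError_succ_target (γ₀ := γ) (γM := γ) (N := N) (i := i) (Nat.zero_le t)
    rwa [targetSpectrum_of_ne_zero hi] at this
  have hv0 : 0 ≤ v 0 N := I.coordError_nonneg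
  have hv1 : v 1 N ≤ ∑ i : Fin I.K, v i.succ N := by
    obtain ⟨j, hj⟩ := Fin.exists_succ_eq.2 hne
    rw [← hj]
    exact Finset.single_le_sum (f := fun i : Fin I.K => v i.succ N)
      (fun i _ => I.coordError_nonneg) (Finset.mem_univ j)
  have hp1 : p ^ 2 ≤ v 1 N := by
    have := mul_prod_sq_le_of_recursion (hrec 1 hne) hr0.le
    have h : v 1 0 = 1 := by
      simp only [v, coordError_initial, I.inner_e_wStar h0 h1']
      simp
    rwa [h, one_mul] at this
  -- The risk bound gives `r p² < 2ε = 2r²`, hence `p² < 2r < 1/4`; this fixes the threshold `1/64`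
  -- for `ε`.
  have hp2 : p ≤ 1 / 2 := by
    have : r * p ^ 2 < r * (2 * r) := by
      have := mul_le_mul_of_nonneg_left (hp1.trans hv1) hr0.le
      nlinarith
    have := lt_of_mul_lt_mul_left this hr0.le
    nlinarith
  -- Every weak coordinate, with or without signal, accumulates noise with the same product `p`, and
  -- `(1 - p)² ≥ 1/4`.
  have hsum : (I.K : ℝ) * (1 / 4) ≤ N * (r * ∑ i : Fin I.K, v i.succ N) := by
    have : ∑ _i : Fin I.K, (1 / 4 : ℝ) ≤ ∑ i : Fin I.K, N * (r * v i.succ N) := by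
      refine Finset.sum_le_sum fun i _ => ?_
      refine le_trans ?_ (one_sub_prod_sq_le_of_recursion (hrec i.succ (Fin.succ_ne_zero i)) hr0.le
        I.coordError_nonneg)
      nlinarith
    rw [Finset.mul_sum, Finset.mul_sum]
    simpa using this
  have hN : (0 : ℝ) ≤ N := Nat.cast_nonneg N
  have hK := I.inv_le_K h0 h1'
  have h2 : r * ∑ i : Fin I.K, v i.succ N ≤ 2 * ε := by linarith
  have h3 : r⁻¹ * (1 / 4) ≤ N * (2 * ε) := by
    have := mul_le_mul_of_nonneg_left h2 hN
    linarith
  have h4 : ε ^ (-(3 / 2) : ℝ) = r⁻¹ * ε⁻¹ := by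
    rw [← Real.rpow_neg_one ε, ← rpow_neg_half h0, ← Real.rpow_add h0]
    norm_num
  rw [h4]
  calc 1 / 8 * (r⁻¹ * ε⁻¹) = r⁻¹ * (1 / 4) * (1 / (2 * ε)) := by field_simp; norm_num
    _ ≤ N * (2 * ε) * (1 / (2 * ε)) := by gcongr
    _ = N := by field_simp

lemma one_le_norm_G (h0 : 0 < ε) (h1 : ε < 1) : 1 ≤ ‖I.G‖ := by
  have h := I.G.le_opNorm (I.e 1)
  have h2 := real_inner_le_norm (I.e 1) (I.G (I.e 1))
  rw [G, inner_basis_diagOp I.orthonormal, I.sourceSpectrum_one h0 h1] at h2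
  rw [I.orthonormal.1, mul_one] at h
  simp only [real_inner_self_eq_norm_sq, I.orthonormal.1] at h2
  rw [G] at h ⊢
  linarith

/-- Pretraining needs order `ε ^ (-2)` source data. -/
lemma pretraining_lower_bound (h0 : 0 < ε) (h1 : ε < 1 / 8) {γ : ℝ} (hγ : 0 < γ)
    (hγ1 : γ < 1 / ‖I.G‖) (hrisk : I.expectedRisk γ γ M 0 < ε) :
    1 / 2 * ε ^ (-2 : ℝ) ≤ M := by
  have h1' : ε < 1 := by linarith
  have hG := I.one_le_norm_G h0 h1'
  have hγ1' : γ ≤ 1 := hγ1.le.trans (by rw [div_le_one (by linarith)]; exact hG)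
  by_contra! hM
  have hM2 : M * ε ^ 2 < 1 / 2 := by
    have e : ε ^ (-2 : ℝ) = (ε ^ 2)⁻¹ := by
      rw [Real.rpow_neg h0.le]
      norm_num
    rw [e] at hM
    have := mul_lt_mul_of_pos_right hM (by positivity : 0 < ε ^ 2)
    rwa [mul_assoc, inv_mul_cancel₀ (by positivity), mul_one] at this
  have hprod := mul_prod_sq_le_of_recursion (n := M) (s := ε ^ 2)
    (v := I.coordError γ γ M 0 0) (g := stepSize γ γ M 0) (fun t ht => by
      have := I.le_coordError_succ_source (γ₀ := γ) (γM := γ) (N := 0) (i := 0) ht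
      rwa [sourceSpectrum_zero] at this) (by positivity)
  -- Bernoulli's inequality. The error in coordinate 0 is then at least `1/4` and the risk at least
  -- `1/8`, the threshold for `ε`.
  have hge : 1 / 2 ≤ ∏ t ∈ Finset.range M, (1 - stepSize γ γ M 0 t * ε ^ 2) := by
    calc (1 / 2 : ℝ) ≤ 1 + M * (-ε ^ 2) := by linarith
      _ ≤ (1 + -ε ^ 2) ^ M := one_add_mul_le_pow (by nlinarith) M
      _ = ∏ t ∈ Finset.range M, (1 + -ε ^ 2) := by simp
      _ ≤ _ := by
        refine Finset.prod_le_prod (fun t _ => by nlinarith) fun t ht => ?_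
        have : stepSize γ γ M 0 t ≤ 1 := by
          rw [stepSize_source (Finset.mem_range.1 ht)]
          exact (div_two_pow_le hγ.le _).trans hγ1'
        nlinarith [sq_nonneg ε]
  have hinit : I.coordError γ γ M 0 0 0 = 1 := by
    rw [coordError_initial, I.inner_e_wStar h0 h1']
    simp
  rw [hinit, one_mul] at hprod
  rw [expectedRisk_eq, sum_targetSpectrum_mul, add_zero] at hrisk
  have hs : 0 ≤ ε ^ (1 / 2 : ℝ) * ∑ i : Fin I.K, I.coordError γ γ M 0 i.succ M :=
    mul_nonneg (by positivity) (Finset.sum_nonneg fun i _ => I.coordError_nonneg)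
  nlinarith

end ShiftInstance

/-! ### Scalar recursions: contraction up to a noise floor. -/

section ScalarUpperBounds

/-- Linear recursions with stepsizes in `[l, h]`: the initial value is contracted at rate `l`, and
the accumulated noise is of order `h`. -/
lemma le_exp_mul_add_of_recursion {u g : ℕ → ℝ} {σ C l h : ℝ} {a b : ℕ} (hab : a ≤ b)
    (hrec : ∀ t, a ≤ t → t < b → u (t + 1) ≤ (1 - 2 * g t * σ) * u t + g t ^ 2 * σ * C)
    (hl : ∀ t, a ≤ t → t < b → l ≤ g t) (hh : ∀ t, a ≤ t → t < b → g t ≤ h)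
    (hl0 : 0 ≤ l) (hh0 : 0 ≤ h) (hσ : 0 ≤ σ) (hhσ : 2 * h * σ ≤ 1) (hC : 0 ≤ C)
    (hu : 0 ≤ u a) :
    u b ≤ Real.exp (-(2 * l * σ * ((b : ℝ) - a))) * u a + h * C / 2 := by
  -- `h * C / 2` is the fixed point of the recursion with constant stepsize `h`. Stepsizes below `h`
  -- have a lower fixed point, so the excess over it is multiplied by at most `1 - 2gσ`.
  have key : ∀ n, a + n ≤ b → u (a + n) - h * C / 2 ≤ Real.exp (-(2 * l * σ)) ^ n * u a := by
    intro n
    induction n with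
    | zero =>
      intro _
      have : 0 ≤ h * C / 2 := by positivity
      simpa using this
    | succ n ih =>
      intro hn
      have h1 := ih (by omega)
      have h2 := hrec (a + n) (by omega) (by omega)
      have h3 := hl (a + n) (by omega) (by omega)
      have h4 := hh (a + n) (by omega) (by omega)
      set G := g (a + n)
      have hG0 : 0 ≤ G := hl0.trans h3
      have hGh : 2 * G * σ ≤ 1 := le_trans (by gcongr) hhσ
      have hlG : 2 * l * σ ≤ 2 * G * σ := by gcongr
      have h5 : 1 - 2 * G * σ ≤ Real.exp (-(2 * l * σ)) := by
        linarith [Real.one_sub_le_exp_neg (2 * l * σ)]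
      have hy : 0 ≤ Real.exp (-(2 * l * σ)) ^ n * u a := by positivity
      have h6 : G ^ 2 * σ * C ≤ G * σ * h * C := by
        rw [show G * σ * h * C = G * h * σ * C by ring, sq]
        gcongr
      calc u (a + (n + 1)) - h * C / 2 ≤ (1 - 2 * G * σ) * (u (a + n) - h * C / 2) := by
            rw [← add_assoc]
            linarith
        _ ≤ (1 - 2 * G * σ) * (Real.exp (-(2 * l * σ)) ^ n * u a) := by
            gcongr
        _ ≤ Real.exp (-(2 * l * σ)) * (Real.exp (-(2 * l * σ)) ^ n * u a) := by gcongr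
        _ = _ := by ring
  have h := key (b - a) (by omega)
  rw [Nat.add_sub_cancel' hab, ← Real.exp_nat_mul, Nat.cast_sub hab] at h
  rw [show -(2 * l * σ * ((b : ℝ) - a)) = ((b : ℝ) - a) * -(2 * l * σ) by ring]
  linarith

end ScalarUpperBounds

/-! ### Asymptotic comparisons with powers and logarithms. -/

section Asymptotics

open Filter

lemma eventually_const_mul_log_sq_le_rpow (B : ℝ) {p : ℝ} (hp : 0 < p) :
    ∀ᶠ x : ℝ in atTop, B * Real.log x ^ 2 ≤ x ^ p := by
  have h := (isLittleO_log_rpow_rpow_atTop 2 hp).bound (c := (|B| + 1)⁻¹) (by positivity)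
  filter_upwards [h, eventually_ge_atTop 1] with x hx hx1
  have hlog := Real.log_nonneg hx1
  rw [Real.norm_of_nonneg (by positivity), Real.norm_of_nonneg (by positivity),
    Real.rpow_two, inv_mul_eq_div, le_div_iff₀ (by positivity)] at hx
  nlinarith [le_abs_self B, sq_nonneg (Real.log x)]

/-- With `x` the number of source data, this is the error after the last pretraining stage. Its
stepsizes lie between orders `x^{-0.7}` and `x^{-0.6}`: over about `x / log x` steps the former
still contracts strongly, and the latter puts the noise below `x^{-1/2}`. -/
lemma eventually_exp_add_rpow_le {a : ℝ} (ha : 0 < a) (C : ℝ) :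
    ∀ᶠ x : ℝ in atTop, Real.exp (-(2 * (a / x ^ (7 / 10 : ℝ)) * (x / Real.log x - 1)))
      + x ^ (-(6 / 10) : ℝ) * C / 2 ≤ x ^ (-(1 / 2) : ℝ) / 20 := by
  have h1 := (isLittleO_log_rpow_atTop (show (0 : ℝ) < 1 / 10 by norm_num)).bound
    (c := min (1 / 2) a) (by positivity)
  have h2 := (tendsto_rpow_atTop (show (0 : ℝ) < 1 / 10 by norm_num)).eventually_ge_atTop
    (max (20 * C) 40)
  filter_upwards [h1, h2, eventually_gt_atTop 3] with x hx1 hx2 hx3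
  have hx0 : 0 < x := by linarith
  have hlog : 1 ≤ Real.log x := by
    rw [Real.le_log_iff_exp_le hx0]
    linarith [Real.exp_one_lt_d9]
  rw [Real.norm_of_nonneg (by linarith), Real.norm_of_nonneg (by positivity)] at hx1
  set q := x ^ (1 / 10 : ℝ) with hq
  have hq40 : 40 ≤ q := (le_max_right _ _).trans hx2
  have hqC : 20 * C ≤ q := (le_max_left _ _).trans hx2
  have hpow : ∀ k : ℕ, x ^ ((k : ℝ) / 10) = q ^ k := fun k => by
    rw [hq, ← Real.rpow_natCast, ← Real.rpow_mul hx0.le]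
    congr 1
    ring
  have e7 : x ^ (7 / 10 : ℝ) = q ^ 7 := by simpa using hpow 7
  have e10 : x = q ^ 10 := by simpa using hpow 10
  have e5 : x ^ (-(1 / 2) : ℝ) = (q ^ 5)⁻¹ := by
    rw [Real.rpow_neg hx0.le, ← hpow 5]
    norm_num
  have e6 : x ^ (-(6 / 10) : ℝ) = (q ^ 6)⁻¹ := by
    rw [Real.rpow_neg hx0.le, ← hpow 6]
    norm_num
  have hq0 : 0 < q := by linarith
  have hlog1 : Real.log x ≤ 1 / 2 * q := hx1.trans (by gcongr; exact min_le_left _ _)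
  have hlog2 : Real.log x ≤ a * q := hx1.trans (by gcongr; exact min_le_right _ _)
  have hdiv : q ^ 9 ≤ x / Real.log x - 1 := by
    have : 2 * q ^ 9 ≤ x / Real.log x := by
      rw [le_div_iff₀ (by linarith)]
      calc 2 * q ^ 9 * Real.log x ≤ 2 * q ^ 9 * (1 / 2 * q) := by gcongr
        _ = q ^ 10 := by ring
        _ = x := e10.symm
    have : 1 ≤ q ^ 9 := one_le_pow₀ (by linarith)
    linarith
  have hexp : Real.exp (-(2 * (a / x ^ (7 / 10 : ℝ)) * (x / Real.log x - 1))) ≤ (q ^ 10)⁻¹ := by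
    rw [← e10, ← Real.exp_log hx0, ← Real.exp_neg, Real.exp_le_exp, Real.exp_log hx0, neg_le_neg_iff]
    calc Real.log x ≤ a * q * 1 := by linarith
      _ ≤ a * q * (2 * q) := by gcongr; linarith
      _ = 2 * (a / q ^ 7) * q ^ 9 := by field_simp
      _ ≤ _ := by rw [e7]; gcongr
  have h10 : (q ^ 10)⁻¹ ≤ (q ^ 5)⁻¹ / 40 := by
    rw [inv_eq_one_div, inv_eq_one_div, div_div, div_le_div_iff₀ (by positivity) (by positivity)]
    have : 1 ≤ q ^ 4 := one_le_pow₀ (by linarith)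
    have : q ^ 5 * 40 ≤ q ^ 5 * (q * q ^ 4) := by gcongr; nlinarith
    nlinarith
  have h6 : (q ^ 6)⁻¹ * C / 2 ≤ (q ^ 5)⁻¹ / 40 := by
    rw [inv_mul_eq_div, div_div, inv_eq_one_div, div_div,
      div_le_div_iff₀ (by positivity) (by positivity)]
    have : 0 ≤ q ^ 5 * (q - 20 * C) := mul_nonneg (by positivity) (by linarith)
    nlinarith
  rw [e5, e6]
  linarith

end Asymptotics

/-! ### Uniform bounds on the errors, and pretraining. -/

namespace ShiftInstance

universe u

variable {E : Type u} [NormedAddCommGroup E] [InnerProductSpace ℝ E] [CompleteSpace E]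
  [MeasurableSpace E] [BorelSpace E] [SecondCountableTopology E]
  {ε : ℝ} (I : ShiftInstance ε E)
  {γ₀ γM α : ℝ} {M N t : ℕ} {i : Fin (I.K + 1)}

section Uniform

variable (h0 : 0 < ε) (h1 : ε < 1) (hα : I.FourthMoment α)
  (hγ₀ : 0 ≤ γ₀) (hγ₀' : γ₀ ≤ 1 / 2) (hγ₀α : γ₀ * (1 + 4 * α) ≤ 2)
  (hγM : 0 ≤ γM) (hγM' : γM ≤ 1 / 2) (hγMα : γM * (1 + 4 * α) ≤ 2)

lemma traceG_le (h0 : 0 < ε) (h1 : ε < 1) : I.traceG ≤ 4 := by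
  rw [I.traceG_eq h0 h1]
  nlinarith

lemma traceH_le (h0 : 0 < ε) (h1 : ε < 1) : I.traceH ≤ 4 := by
  rw [I.traceH_eq]
  linarith [I.K_mul_le h0 h1]

-- While all errors are at most 1, the weighted total error is at most the trace, hence at most 4.
-- The coordinates decouple, with effective noise level `1 + 4 * α`.
include h0 h1 hα in
lemma coordError_step_source (ht : t < M) (hv : ∀ j, I.coordError γ₀ γM M N j t ≤ 1)
    (i : Fin (I.K + 1)) :
    I.coordError γ₀ γM M N i (t + 1)
      ≤ (1 - 2 * stepSize γ₀ γM M N t * sourceSpectrum ε I.K i) * I.coordError γ₀ γM M N i t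
        + stepSize γ₀ γM M N t ^ 2 * sourceSpectrum ε I.K i * (1 + 4 * α) := by
  refine (I.coordError_succ_le_source hα ht).trans ?_
  have hα1 := I.one_le_of_fourthMoment hα
  have hs : ∑ j, sourceSpectrum ε I.K j * I.coordError γ₀ γM M N j t ≤ 4 := by
    refine le_trans (Finset.sum_le_sum fun j _ => ?_) (I.traceG_le h0 h1)
    exact mul_le_of_le_one_right (sourceSpectrum_nonneg _ _) (hv j)
  have hσ := sourceSpectrum_nonneg (ε := ε) I.K i
  have h4 := mul_le_mul_of_nonneg_left hs (zero_le_one.trans hα1)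
  have h5 : 1 + α * ∑ j, sourceSpectrum ε I.K j * I.coordError γ₀ γM M N j t ≤ 1 + 4 * α := by
    linarith
  have h6 := mul_le_mul_of_nonneg_left h5 (mul_nonneg (sq_nonneg (stepSize γ₀ γM M N t)) hσ)
  linarith

include h0 h1 hα in
lemma coordError_step_target (ht : M ≤ t) (hv : ∀ j, I.coordError γ₀ γM M N j t ≤ 1)
    (i : Fin (I.K + 1)) :
    I.coordError γ₀ γM M N i (t + 1)
      ≤ (1 - 2 * stepSize γ₀ γM M N t * targetSpectrum ε I.K i) * I.coordError γ₀ γM M N i t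
        + stepSize γ₀ γM M N t ^ 2 * targetSpectrum ε I.K i * (1 + 4 * α) := by
  refine (I.coordError_succ_le_target hα ht).trans ?_
  have hα1 := I.one_le_of_fourthMoment hα
  have hs : ∑ j, targetSpectrum ε I.K j * I.coordError γ₀ γM M N j t ≤ 4 := by
    refine le_trans (Finset.sum_le_sum fun j _ => ?_) (I.traceH_le h0 h1)
    exact mul_le_of_le_one_right (targetSpectrum_nonneg h0 _ _) (hv j)
  have hσ := targetSpectrum_nonneg h0 I.K i
  have h4 := mul_le_mul_of_nonneg_left hs (zero_le_one.trans hα1)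
  have h5 : 1 + α * ∑ j, targetSpectrum ε I.K j * I.coordError γ₀ γM M N j t ≤ 1 + 4 * α := by
    linarith
  have h6 := mul_le_mul_of_nonneg_left h5 (mul_nonneg (sq_nonneg (stepSize γ₀ γM M N t)) hσ)
  linarith

include h0 h1 hα hγ₀ hγ₀' hγ₀α hγM hγM' hγMα in
/-- The coordinates of the error never exceed their initial bound. -/
lemma coordError_le_one (t : ℕ) : ∀ i, I.coordError γ₀ γM M N i t ≤ 1 := by
  -- The noise term is at most `2gσ`, which is exactly what the contraction removes at level 1.
  have box : ∀ {γ g σ u : ℝ}, 0 ≤ g → g ≤ γ → γ ≤ 1 / 2 → γ * (1 + 4 * α) ≤ 2 → 0 ≤ σ → σ ≤ 1 →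
      u ≤ 1 → (1 - 2 * g * σ) * u + g ^ 2 * σ * (1 + 4 * α) ≤ 1 := by
    intro γ g σ u hg hgγ hγ hγα hσ hσ1 hu
    have hα1 := I.one_le_of_fourthMoment hα
    have hgσ : g * σ ≤ 1 / 2 := by nlinarith
    have h2 : g * (1 + 4 * α) ≤ 2 := le_trans (by gcongr) hγα
    have h3 : (g * σ) * (g * (1 + 4 * α)) ≤ (g * σ) * 2 := by gcongr
    have h4 : (1 - 2 * g * σ) * u ≤ (1 - 2 * g * σ) * 1 := by
      gcongr
      linarith
    nlinarith
  induction t with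
  | zero =>
    intro i
    rw [coordError_initial]
    exact I.sq_inner_e_wStar_le_one h0 h1 i
  | succ t ih =>
    intro i
    rcases lt_or_ge t M with ht | ht
    · refine (I.coordError_step_source h0 h1 hα ht ih i).trans ?_
      refine box (γ := γ₀) ?_ ?_ hγ₀' hγ₀α (sourceSpectrum_nonneg _ _)
        (sourceSpectrum_le_one h0 h1 _ _) (ih i) <;> rw [stepSize_source ht]
      exacts [div_two_pow_nonneg hγ₀ _, div_two_pow_le hγ₀ _]
    · refine (I.coordError_step_target h0 h1 hα ht ih i).trans ?_
      refine box (γ := γM) ?_ ?_ hγM' hγMα (targetSpectrum_nonneg h0 _ _)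
        (targetSpectrum_le_one h0 h1 _ _) (ih i) <;> rw [stepSize_target ht]
      exacts [div_two_pow_nonneg hγM _, div_two_pow_le hγM _]

include h0 h1 hα in
/-- Pretraining does not affect the coordinates that the source does not see. -/
lemma coordError_source_invisible (hi0 : i ≠ 0) (hi1 : i ≠ 1) (ht : t ≤ M) :
    I.coordError γ₀ γM M N i t ≤ 0 := by
  induction t with
  | zero =>
    rw [coordError_initial, I.inner_e_wStar h0 h1]
    simp [hi0, hi1]
  | succ t ih =>
    refine (I.coordError_succ_le_source hα ht).trans ?_
    rw [sourceSpectrum_of_ne hi0 hi1]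
    simpa using ih (by omega)

include h0 h1 hα hγ₀ hγ₀' hγ₀α hγM hγM' hγMα in
/-- Pretraining: the last `M / log M` steps reduce the error along the main source direction. -/
lemma coordError_one_le (hγ₀4 : γ₀ ≤ 1 / 4) {a₀ : ℝ} (ha₀ : 0 ≤ a₀) (ha : a₀ ≤ γ₀) (hM : 4 ≤ M) :
    I.coordError γ₀ γM M N 1 M
      ≤ Real.exp (-(2 * (a₀ / (M : ℝ) ^ (7 / 10 : ℝ)) * ((M : ℝ) / Real.log M - 1)))
        + (M : ℝ) ^ (-(6 / 10) : ℝ) * (1 + 4 * α) / 2 := by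
  have hα1 := I.one_le_of_fourthMoment hα
  have hbox := I.coordError_le_one (M := M) (N := N) h0 h1 hα hγ₀ hγ₀' hγ₀α hγM hγM' hγMα
  have hM4 : (4 : ℝ) ≤ M := by exact_mod_cast hM
  have hM0 : (0 : ℝ) < M := by linarith
  have hlog : 1 ≤ Real.log M := by
    rw [Real.le_log_iff_exp_le hM0]
    linarith [Real.exp_one_lt_d9]
  have hlog0 : 0 < Real.log M := by linarith
  set L := (M : ℝ) / Real.log M with hL
  have hL0 : 0 < L := by positivity
  have hLM : L ≤ M := div_le_self hM0.le hlog
  have hML : (M : ℝ) / L = Real.log M := by rw [hL]; field_simp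
  set a := ⌈(M : ℝ) - L⌉₊ with ha_def
  have haM : a ≤ M := Nat.ceil_le.2 (by linarith)
  have ha_lt : (a : ℝ) < M - L + 1 := Nat.ceil_lt_add_one (by linarith)
  -- In this window `t / L` lies between `log M - 1` and `log M`; the floor costs one more.
  have hexp : ∀ t, a ≤ t → t < M → (⌊(t : ℝ) / L⌋₊ : ℝ) ≤ Real.log M ∧
      Real.log M - 2 ≤ (⌊(t : ℝ) / L⌋₊ : ℝ) := by
    intro t hat htM
    have h1 : (M : ℝ) - L ≤ t := (Nat.ceil_le.1 hat)
    have h2 : (t : ℝ) < M := by exact_mod_cast htM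
    constructor
    · refine (Nat.floor_le (by positivity)).trans ?_
      rw [← hML]
      gcongr
    · have h3 := Nat.lt_floor_add_one ((t : ℝ) / L)
      have h4 : Real.log M - 1 ≤ (t : ℝ) / L := by
        rw [le_div_iff₀ hL0, sub_mul, ← hML, div_mul_cancel₀ _ hL0.ne']
        linarith
      linarith
  -- Natural logarithms turn the halvings into the power `log 2` of `M`, which lies between `0.6`
  -- and `0.7`. The factor `2² = 4` lost in the lower bound on the exponent is paid for by `γ₀ ≤
  -- 1/4`.
  have hpow : (2 : ℝ) ^ (Real.log M) = (M : ℝ) ^ (Real.log 2) := by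
    rw [Real.rpow_def_of_pos (by norm_num), Real.rpow_def_of_pos hM0, mul_comm]
  have hg : ∀ t, a ≤ t → t < M → a₀ / (M : ℝ) ^ (7 / 10 : ℝ) ≤ stepSize γ₀ γM M N t ∧
      stepSize γ₀ γM M N t ≤ (M : ℝ) ^ (-(6 / 10) : ℝ) := by
    intro t hat htM
    obtain ⟨hu, hl⟩ := hexp t hat htM
    rw [stepSize_source htM, ← hL, ← Real.rpow_natCast]
    constructor
    · have : (2 : ℝ) ^ (⌊(t : ℝ) / L⌋₊ : ℝ) ≤ (M : ℝ) ^ (7 / 10 : ℝ) :=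
        calc (2 : ℝ) ^ (⌊(t : ℝ) / L⌋₊ : ℝ) ≤ 2 ^ (Real.log M) :=
              Real.rpow_le_rpow_of_exponent_le (by norm_num) hu
          _ ≤ _ := by
              rw [hpow]
              exact Real.rpow_le_rpow_of_exponent_le (by linarith)
                (by linarith [Real.log_two_lt_d9])
      gcongr
    · have : (M : ℝ) ^ (6 / 10 : ℝ) / 4 ≤ (2 : ℝ) ^ (⌊(t : ℝ) / L⌋₊ : ℝ) :=
        calc (M : ℝ) ^ (6 / 10 : ℝ) / 4 ≤ (M : ℝ) ^ (Real.log 2) / 4 := by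
              gcongr
              · linarith
              · linarith [Real.log_two_gt_d9]
          _ = 2 ^ (Real.log M - 2) := by
              rw [Real.rpow_sub (by norm_num), hpow]
              norm_num
          _ ≤ _ := Real.rpow_le_rpow_of_exponent_le (by norm_num) hl
      rw [Real.rpow_neg hM0.le, div_le_iff₀ (by positivity)]
      have hp : 0 < (M : ℝ) ^ (6 / 10 : ℝ) := by positivity
      calc γ₀ ≤ 1 / 4 := hγ₀4
        _ = ((M : ℝ) ^ (6 / 10 : ℝ))⁻¹ * ((M : ℝ) ^ (6 / 10 : ℝ) / 4) := by field_simp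
        _ ≤ _ := by gcongr
  have hh : (M : ℝ) ^ (-(6 / 10) : ℝ) ≤ 1 / 2 :=
    calc (M : ℝ) ^ (-(6 / 10) : ℝ) ≤ 4 ^ (-(6 / 10) : ℝ) :=
          Real.rpow_le_rpow_of_nonpos (by norm_num) hM4 (by norm_num)
      _ ≤ 4 ^ (-(1 / 2) : ℝ) := Real.rpow_le_rpow_of_exponent_le (by norm_num) (by norm_num)
      _ = 1 / 2 := by
          rw [show (4 : ℝ) = 2 ^ (2 : ℝ) by norm_num, ← Real.rpow_mul (by norm_num)]
          norm_num [Real.rpow_neg_one]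
  have key := le_exp_mul_add_of_recursion (u := I.coordError γ₀ γM M N 1)
    (g := stepSize γ₀ γM M N) (σ := 1) (C := 1 + 4 * α) haM
    (fun t _ htM => by
      have := I.coordError_step_source h0 h1 hα htM (hbox t) 1
      rwa [I.sourceSpectrum_one h0 h1] at this)
    (fun t hat htM => (hg t hat htM).1) (fun t hat htM => (hg t hat htM).2)
    (by positivity) (by positivity) zero_le_one (by linarith) (by linarith) I.coordError_nonneg
  refine key.trans ?_
  gcongr
  rw [mul_one]
  exact (mul_le_of_le_one_right (Real.exp_nonneg _) (hbox a 1)).trans (Real.exp_le_exp.2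
    (neg_le_neg (mul_le_mul_of_nonneg_left (by linarith) (by positivity))))

end Uniform

end ShiftInstance

/-! ### Finetuning: weak coordinates and leading coordinate. -/

namespace ShiftInstance

universe u

variable {E : Type u} [NormedAddCommGroup E] [InnerProductSpace ℝ E] [CompleteSpace E]
  [MeasurableSpace E] [BorelSpace E] [SecondCountableTopology E]
  {ε : ℝ} (I : ShiftInstance ε E)
  {γ₀ γM α : ℝ} {M N t : ℕ} {i : Fin (I.K + 1)}

/-- Finetuning, in the coordinates of small target variance: little noise is accumulated. -/
lemma sum_coordError_succ_le (h0 : 0 < ε) (h1 : ε < 1) (hα : I.FourthMoment α)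
    (hγM : 0 ≤ γM) (hbox : ∀ t i, I.coordError γ₀ γM M N i t ≤ 1) :
    ∑ i : Fin I.K, I.coordError γ₀ γM M N i.succ (M + N)
      ≤ I.coordError γ₀ γM M N 1 M + 3 * N * γM ^ 2 * (1 + 4 * α) := by
  have hα1 := I.one_le_of_fourthMoment hα
  set r := ε ^ (1 / 2 : ℝ) with hr
  have hr0 : 0 < r := by positivity
  have hinit : ∑ i : Fin I.K, I.coordError γ₀ γM M N i.succ M ≤ I.coordError γ₀ γM M N 1 M := by
    obtain ⟨j, hj⟩ := Fin.exists_succ_eq.2 (I.one_ne_zero_index h0 h1)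
    rw [← hj, ← Finset.sum_erase_add _ _ (Finset.mem_univ j)]
    have : ∑ i ∈ Finset.univ.erase j, I.coordError γ₀ γM M N i.succ M ≤ 0 := by
      refine Finset.sum_nonpos fun i hi => ?_
      refine I.coordError_source_invisible h0 h1 hα (Fin.succ_ne_zero i) ?_ le_rfl
      rw [← hj]
      exact fun h => Finset.ne_of_mem_erase hi (Fin.succ_injective _ h)
    linarith
  -- Contraction is discarded here: the noise of all `N` steps is small enough even when simply
  -- added up.
  have hstep : ∀ (i : Fin I.K) (n : ℕ), I.coordError γ₀ γM M N i.succ (M + n)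
      ≤ I.coordError γ₀ γM M N i.succ M + n * (γM ^ 2 * r * (1 + 4 * α)) := by
    intro i n
    induction n with
    | zero => simp
    | succ n ih =>
      have h := I.coordError_step_target h0 h1 hα (Nat.le_add_right M n) (hbox _) i.succ
      rw [targetSpectrum_of_ne_zero (Fin.succ_ne_zero i), stepSize_target (Nat.le_add_right M n)]
        at h
      have hg0 := div_two_pow_nonneg hγM ⌊(((M + n : ℕ) : ℝ) - M) / (N / Real.log N)⌋₊
      have hg1 := div_two_pow_le hγM ⌊(((M + n : ℕ) : ℝ) - M) / (N / Real.log N)⌋₊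
      set g := γM / 2 ^ ⌊(((M + n : ℕ) : ℝ) - M) / (N / Real.log N)⌋₊
      have h2 : g ^ 2 * r * (1 + 4 * α) ≤ γM ^ 2 * r * (1 + 4 * α) := by gcongr
      have h3 : 0 ≤ 2 * g * r * I.coordError γ₀ γM M N i.succ (M + n) :=
        mul_nonneg (by positivity) I.coordError_nonneg
      push_cast
      rw [← add_assoc]
      linarith
  have hK := I.K_mul_le h0 h1
  calc ∑ i : Fin I.K, I.coordError γ₀ γM M N i.succ (M + N)
      ≤ ∑ i : Fin I.K, (I.coordError γ₀ γM M N i.succ M + N * (γM ^ 2 * r * (1 + 4 * α))) :=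
        Finset.sum_le_sum fun i _ => hstep i N
    _ = ∑ i : Fin I.K, I.coordError γ₀ γM M N i.succ M
          + (I.K * r) * (N * γM ^ 2 * (1 + 4 * α)) := by
        rw [Finset.sum_add_distrib]
        simp
        ring
    _ ≤ I.coordError γ₀ γM M N 1 M + 3 * (N * γM ^ 2 * (1 + 4 * α)) := by gcongr
    _ = _ := by ring

/-- Finetuning, in the leading target coordinate: the first stage contracts, a later stage (of
index `ℓ`) removes the noise of the first one. -/
lemma coordError_zero_le (h0 : 0 < ε) (h1 : ε < 1) (hα : I.FourthMoment α)
    (hγM : 0 ≤ γM) (hγM' : γM ≤ 1 / 2) (hbox : ∀ t i, I.coordError γ₀ γM M N i t ≤ 1)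
    {ℓ : ℕ} (hℓ : 1 ≤ ℓ) (hN : (ℓ : ℝ) + 1 ≤ Real.log N) :
    I.coordError γ₀ γM M N 0 (M + N)
      ≤ Real.exp (-(2 * (γM / 2 ^ ℓ) * (N / Real.log N - 1)))
          * (Real.exp (-(2 * γM * (N / Real.log N))) + γM * (1 + 4 * α))
        + γM / 2 ^ ℓ * (1 + 4 * α) := by
  have hα1 := I.one_le_of_fourthMoment hα
  have hlog : 0 < Real.log N := by
    have : (0 : ℝ) ≤ ℓ := Nat.cast_nonneg ℓ
    linarith
  have hN0 : (0 : ℝ) < N := by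
    rcases (Nat.cast_nonneg (α := ℝ) N).eq_or_lt with h | h
    · rw [← h] at hlog
      simp at hlog
    · exact h
  set L := (N : ℝ) / Real.log N with hL
  have hL0 : 0 < L := by positivity
  have hLN : ((ℓ : ℝ) + 1) * L ≤ N := by
    rw [hL, mul_div_assoc', div_le_iff₀ hlog]
    nlinarith
  set C := 1 + 4 * α with hC
  have hC0 : 0 ≤ C := by linarith
  set u : ℕ → ℝ := fun n => I.coordError γ₀ γM M N 0 (M + n) with hu
  set g : ℕ → ℝ := fun n => γM / 2 ^ ⌊(n : ℝ) / L⌋₊ with hg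
  have hu0 : ∀ n, 0 ≤ u n := fun n => I.coordError_nonneg
  have hrec : ∀ n, u (n + 1) ≤ (1 - 2 * g n * 1) * u n + g n ^ 2 * 1 * C := by
    intro n
    have h := I.coordError_step_target h0 h1 hα (Nat.le_add_right M n) (hbox _) 0
    rw [targetSpectrum_zero, stepSize_target (Nat.le_add_right M n)] at h
    simpa [hu, hg, ← hL, add_assoc] using h
  have hg_nonneg : ∀ n, 0 ≤ g n := fun n => div_two_pow_nonneg hγM _
  have hg_le : ∀ n, g n ≤ γM := fun n => div_two_pow_le hγM _
  have hδ : 0 ≤ γM / 2 ^ ℓ := div_two_pow_nonneg hγM _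
  have hδ' : γM / 2 ^ ℓ ≤ γM := div_two_pow_le hγM _
  have hg_late : ∀ n : ℕ, (ℓ : ℝ) * L ≤ n → g n ≤ γM / 2 ^ ℓ := by
    intro n hn
    have : ℓ ≤ ⌊(n : ℝ) / L⌋₊ := Nat.le_floor ((le_div_iff₀ hL0).2 hn)
    simp only [hg]
    gcongr
    norm_num
  have hg_early : ∀ (k n : ℕ), (n : ℝ) < (k + 1) * L → γM / 2 ^ k ≤ g n := by
    intro k n hn
    have : ⌊(n : ℝ) / L⌋₊ ≤ k := by
      have : ⌊(n : ℝ) / L⌋₊ < k + 1 := by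
        rw [Nat.floor_lt (by positivity), div_lt_iff₀ hL0]
        exact_mod_cast hn
      omega
    simp only [hg]
    gcongr
    norm_num
  set n₁ := ⌈L⌉₊ with hn₁
  set n₂ := ⌈(ℓ : ℝ) * L⌉₊ with hn₂
  set n₃ := ⌈((ℓ : ℝ) + 1) * L⌉₊ with hn₃
  have hℓ' : (1 : ℝ) ≤ ℓ := by exact_mod_cast hℓ
  have h12 : n₁ ≤ n₂ := Nat.ceil_mono (by nlinarith)
  have h23 : n₂ ≤ n₃ := Nat.ceil_mono (by nlinarith)
  have h3N : n₃ ≤ N := Nat.ceil_le.2 hLN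
  have w₁ := le_exp_mul_add_of_recursion (u := u) (g := g) (l := γM) (h := γM) (Nat.zero_le n₁)
    (fun t _ _ => hrec t)
    (fun t _ ht => by simpa using hg_early 0 t (by simpa using Nat.lt_ceil.1 ht))
    (fun t _ _ => hg_le t) hγM hγM zero_le_one (by linarith) hC0 (hu0 0)
  have w₂ := le_exp_mul_add_of_recursion (u := u) (g := g) (l := 0) (h := γM) h12
    (fun t _ _ => hrec t) (fun t _ _ => hg_nonneg t)
    (fun t _ _ => hg_le t) le_rfl hγM zero_le_one (by linarith) hC0 (hu0 n₁)
  have w₃ := le_exp_mul_add_of_recursion (u := u) (g := g) (l := γM / 2 ^ ℓ) (h := γM / 2 ^ ℓ) h23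
    (fun t _ _ => hrec t) (fun t _ ht => hg_early ℓ t (Nat.lt_ceil.1 ht))
    (fun t ht _ => hg_late t (Nat.ceil_le.1 ht)) hδ hδ zero_le_one (by linarith) hC0 (hu0 n₂)
  have w₄ := le_exp_mul_add_of_recursion (u := u) (g := g) (l := 0) (h := γM / 2 ^ ℓ) h3N
    (fun t _ _ => hrec t) (fun t _ _ => hg_nonneg t)
    (fun t ht _ => hg_late t (Nat.ceil_le.1 (h23.trans ht))) le_rfl hδ zero_le_one (by linarith)
    hC0 (hu0 n₃)
  simp only [mul_zero, zero_mul, neg_zero, Real.exp_zero, one_mul, mul_one] at w₁ w₂ w₃ w₄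
  have b₁ : u n₁ ≤ Real.exp (-(2 * γM * L)) + γM * C / 2 := by
    refine w₁.trans ?_
    gcongr
    refine (mul_le_of_le_one_right (Real.exp_nonneg _) (hbox _ _)).trans ?_
    gcongr
    simpa using Nat.le_ceil L
  -- Rounding the start of stage `ℓ` up to an integer can cost one step.
  have hn32 : L - 1 ≤ (n₃ : ℝ) - n₂ := by
    have e₃ : ((ℓ : ℝ) + 1) * L ≤ n₃ := Nat.le_ceil _
    have e₂ : (n₂ : ℝ) < ℓ * L + 1 := Nat.ceil_lt_add_one (by positivity)
    linarith
  have b₂ : u n₂ ≤ Real.exp (-(2 * γM * L)) + γM * C := by linarith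
  have b₃ : u n₃ ≤ Real.exp (-(2 * (γM / 2 ^ ℓ) * (L - 1)))
      * (Real.exp (-(2 * γM * L)) + γM * C) + γM / 2 ^ ℓ * C / 2 := by
    refine w₃.trans ?_
    have := hu0 n₂
    gcongr
  change u N ≤ _
  linarith

end ShiftInstance

/-! ### Smallness of `ε` and assembly of the upper bound. -/

section Finetuning

open Filter

universe u

/-- What "sufficiently small `ε`" means for pretraining–finetuning, in terms of `x = ε⁻¹`. -/
lemma eventually_finetuning_scale {α a₀ a₁ a₂ a₃ : ℝ} (b₁ b₃ : ℝ) (ha₀ : 0 < a₀) (ha₁ : 0 < a₁)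
    (ha₂ : 0 < a₂) (ha₃ : 0 < a₃) (ℓ : ℕ) :
    ∀ᶠ x : ℝ in atTop, 64 ≤ x ∧ b₁ ≤ x / 2 ∧ b₁ * (1 + 4 * α) ≤ x ∧ 4 / a₃ ≤ x ∧
      (1 ≤ Real.log x ∧ 1 ≤ a₂ * Real.log x ∧ 1 ≤ a₃ * Real.log x ∧ (ℓ : ℝ) + 1 ≤ Real.log x) ∧
      b₃ * Real.log x ^ 2 ≤ x ∧
      60 * b₁ ^ 2 * (1 + 4 * α) * b₃ * Real.log x ^ 2 ≤ x ^ (1 / 2 : ℝ) ∧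
      Real.exp (-(a₁ * a₃ / 2 ^ (ℓ + 1) * Real.log x)) * (1 + b₁ * (1 + 4 * α)) ≤ 1 / 20 ∧
      ∀ m, x ≤ m → Real.exp (-(2 * (a₀ / m ^ (7 / 10 : ℝ)) * (m / Real.log m - 1)))
        + m ^ (-(6 / 10) : ℝ) * (1 + 4 * α) / 2 ≤ m ^ (-(1 / 2) : ℝ) / 20 := by
  have hlog := Real.tendsto_log_atTop
  have hexp : Tendsto (fun x => Real.exp (-(a₁ * a₃ / 2 ^ (ℓ + 1) * Real.log x))
      * (1 + b₁ * (1 + 4 * α))) atTop (nhds (0 * (1 + b₁ * (1 + 4 * α)))) :=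
    (Real.tendsto_exp_neg_atTop_nhds_zero.comp
      (hlog.const_mul_atTop (by positivity))).mul_const _
  rw [zero_mul] at hexp
  have h1 := eventually_const_mul_log_sq_le_rpow b₃ zero_lt_one
  filter_upwards [eventually_ge_atTop 64, eventually_ge_atTop (2 * b₁),
    eventually_ge_atTop (b₁ * (1 + 4 * α)), eventually_ge_atTop (4 / a₃),
    hlog.eventually_ge_atTop 1, hlog.eventually_ge_atTop (1 / a₂),
    hlog.eventually_ge_atTop (1 / a₃), hlog.eventually_ge_atTop ((ℓ : ℝ) + 1), h1,
    eventually_const_mul_log_sq_le_rpow (60 * b₁ ^ 2 * (1 + 4 * α) * b₃) one_half_pos,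
    hexp.eventually_le_const (show (0 : ℝ) < 1 / 20 by norm_num),
    eventually_forall_ge_atTop.2 (eventually_exp_add_rpow_le ha₀ (1 + 4 * α))]
    with x e1 e2 e3 e4 e5 e6 e7 e8 e9 e10 e11 e12
  rw [Real.rpow_one] at e9
  rw [div_le_iff₀' ha₂] at e6
  rw [div_le_iff₀' ha₃] at e7
  exact ⟨e1, by linarith, e3, e4, ⟨e5, e6, e7, e8⟩, e9, e10, e11, e12⟩

theorem ShiftInstance.expectedRisk_finetuning_lt {α a₀ a₁ b₁ a₂ a₃ b₃ : ℝ} (hα : 0 < α)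
    (ha₀ : 0 < a₀) (ha₁ : 0 < a₁) (ha₂ : 0 < a₂) (ha₃ : 0 < a₃) (ha₁₃ : 1 ≤ a₁ * a₃) :
    ∃ ε₀ > (0 : ℝ), ∀ ε : ℝ, 0 < ε → ε < ε₀ →
      ∀ (E : Type u) [NormedAddCommGroup E] [InnerProductSpace ℝ E] [CompleteSpace E]
        [SecondCountableTopology E] [MeasurableSpace E] [BorelSpace E] (I : ShiftInstance ε E),
      I.FourthMoment α → ∀ (γ₀ γM : ℝ) (M N : ℕ), a₀ ≤ γ₀ → γ₀ < 1 / (4 * α * I.traceG) →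
      a₁ * ε ≤ γM → γM ≤ b₁ * ε →
      a₂ * (ε⁻¹ * Real.log ε⁻¹) ≤ M → a₃ * (ε⁻¹ * Real.log ε⁻¹ ^ 2) ≤ N →
      N ≤ b₃ * (ε⁻¹ * Real.log ε⁻¹ ^ 2) → I.expectedRisk γ₀ γM M N < ε := by
  -- The noise after stage 0 is of order `ε` but with too large a constant; `ℓ` halvings repair it.
  -- As `ℓ` is fixed before `ε`, the contraction exponent of stage `ℓ` is still a constant multiple
  -- of `log ε⁻¹`.
  obtain ⟨ℓ, hℓ1, hℓ⟩ : ∃ ℓ : ℕ, 1 ≤ ℓ ∧ b₁ * (1 + 4 * α) / 2 ^ ℓ ≤ 1 / 20 := by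
    have h : Tendsto (fun ℓ : ℕ => b₁ * (1 + 4 * α) / 2 ^ ℓ) atTop (nhds 0) :=
      tendsto_const_nhds.div_atTop (tendsto_pow_atTop_atTop_of_one_lt (by norm_num))
    exact ((eventually_ge_atTop 1).and
      (h.eventually_le_const (show (0 : ℝ) < 1 / 20 by norm_num))).exists
  obtain ⟨X, hX⟩ := eventually_atTop.1
    (eventually_finetuning_scale (α := α) b₁ b₃ ha₀ ha₁ ha₂ ha₃ ℓ)
  refine ⟨(max X 1)⁻¹, by positivity, ?_⟩
  intro ε h0 hε E _ _ _ _ _ _ I hI γ₀ γM M N hγ₀a hγ₀ hγMa hγMb hM hN hNb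
  have hx : X ≤ ε⁻¹ :=
    (le_max_left X 1).trans (by rw [le_inv_comm₀ (by positivity) h0]; exact hε.le)
  obtain ⟨e1, e2, e3, e4, ⟨e5, e6, e7, e8⟩, e9, e10, e11, e12⟩ := hX _ hx
  set x := ε⁻¹ with hxdef
  set lx := Real.log x with hlx
  have hxε : x * ε = 1 := inv_mul_cancel₀ h0.ne'
  have hx0 : 0 < x := by positivity
  have h1 : ε < 1 := (one_lt_inv₀ h0).1 (by linarith)
  have hα1 := I.one_le_of_fourthMoment hI
  set C := 1 + 4 * α with hC
  have hC0 : 0 ≤ C := by linarith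
  have hγ₀0 : 0 ≤ γ₀ := ha₀.le.trans hγ₀a
  have hγM0 : 0 < γM := (by positivity : 0 < a₁ * ε).trans_le hγMa
  have hγ₀α : 4 * α * γ₀ ≤ 1 := by
    have hG : 1 ≤ I.traceG := by
      rw [I.traceG_eq h0 h1]
      linarith [sq_nonneg ε]
    rw [lt_div_iff₀ (by positivity)] at hγ₀
    have : γ₀ * (4 * α) * 1 ≤ γ₀ * (4 * α) * I.traceG := by gcongr
    linarith
  have hγ₀4 : γ₀ ≤ 1 / 4 := by linarith [mul_le_mul_of_nonneg_right hα1 hγ₀0]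
  have hγM2 : γM ≤ 1 / 2 := by
    refine hγMb.trans ?_
    have := mul_le_mul_of_nonneg_right e2 h0.le
    linarith
  have hγMC : γM * C ≤ b₁ * C * ε := by
    have := mul_le_mul_of_nonneg_right hγMb hC0
    linarith
  have hγMC2 : γM * C ≤ 2 := by
    have := mul_le_mul_of_nonneg_right e3 h0.le
    linarith
  have hbox := I.coordError_le_one (M := M) (N := N) h0 h1 hI hγ₀0 (by linarith) (by linarith)
    hγM0.le hγM2 hγMC2
  set r := ε ^ (1 / 2 : ℝ) with hr
  have hr0 : 0 < r := by positivity
  have hr2 : r ^ 2 = ε := ShiftInstance.rpow_half_sq h0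
  have hxr : x ^ (1 / 2 : ℝ) = r⁻¹ := Real.inv_rpow h0.le _
  have hMx : x ≤ M := by
    refine le_trans ?_ hM
    linarith [mul_le_mul_of_nonneg_left e6 hx0.le]
  have hv1 : I.coordError γ₀ γM M N 1 M ≤ r / 20 := by
    have hM4 : 4 ≤ M := by
      have : (4 : ℝ) ≤ M := by linarith
      exact_mod_cast this
    refine (I.coordError_one_le h0 h1 hI hγ₀0 (by linarith) (by linarith) hγM0.le hγM2 hγMC2
      hγ₀4 ha₀.le hγ₀a hM4).trans ((e12 M hMx).trans ?_)
    have : (M : ℝ) ^ (-(1 / 2) : ℝ) ≤ x ^ (-(1 / 2) : ℝ) :=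
      Real.rpow_le_rpow_of_nonpos hx0 hMx (by norm_num)
    rw [Real.rpow_neg hx0.le, hxr, inv_inv] at this
    linarith
  have hxN : x ≤ N := by
    refine le_trans ?_ hN
    have : 1 ≤ a₃ * lx * lx := one_le_mul_of_one_le_of_one_le e7 e5
    linarith [mul_le_mul_of_nonneg_left this hx0.le]
  have hN0 : (0 : ℝ) < N := by linarith
  have hlogN : Real.log N ≤ 2 * lx := by
    have : (N : ℝ) ≤ x ^ 2 := by
      refine hNb.trans ?_
      linarith [mul_le_mul_of_nonneg_left e9 hx0.le]
    calc Real.log N ≤ Real.log (x ^ 2) := Real.log_le_log hN0 this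
      _ = 2 * lx := by rw [Real.log_pow, ← hlx]; norm_num
  have hℓN : (ℓ : ℝ) + 1 ≤ Real.log N := e8.trans (Real.log_le_log hx0 hxN)
  have hlogN0 : 0 < Real.log N := by
    have : (0 : ℝ) ≤ ℓ := Nat.cast_nonneg ℓ
    linarith
  set L := (N : ℝ) / Real.log N with hL
  -- The factor 2 lost here is that of `log N ≤ 2 log x`.
  have hLlow : a₃ * x * lx / 2 ≤ L := by
    rw [hL, le_div_iff₀ hlogN0]
    calc a₃ * x * lx / 2 * Real.log N ≤ a₃ * x * lx / 2 * (2 * lx) := by gcongr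
      _ = a₃ * (x * lx ^ 2) := by ring
      _ ≤ N := hN
  have hLlow' : a₃ * x * lx / 4 ≤ L - 1 := by
    have : 1 ≤ a₃ * x * lx / 4 := by
      rw [div_le_iff₀ ha₃] at e4
      linarith [mul_le_mul_of_nonneg_left e5 (by positivity : 0 ≤ a₃ * x)]
    linarith
  -- The constant `κ = 1` is decided here: the exponent is at least `a₁ a₃ log x`, and it has to
  -- reach `log x`.
  have hexp₁ : Real.exp (-(2 * γM * L)) ≤ ε := by
    have : lx ≤ 2 * γM * L :=
      calc lx ≤ a₁ * a₃ * lx := le_mul_of_one_le_left (by linarith) ha₁₃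
        _ = 2 * (a₁ * ε) * (a₃ * x * lx / 2) := by
          rw [show 2 * (a₁ * ε) * (a₃ * x * lx / 2) = a₁ * a₃ * lx * (x * ε) by ring, hxε, mul_one]
        _ ≤ 2 * γM * L := by gcongr
    calc Real.exp (-(2 * γM * L)) ≤ Real.exp (-lx) := Real.exp_le_exp.2 (neg_le_neg this)
      _ = ε := by rw [Real.exp_neg, hlx, Real.exp_log hx0, hxdef, inv_inv]
  have hexp₂ : Real.exp (-(2 * (γM / 2 ^ ℓ) * (L - 1)))
      ≤ Real.exp (-(a₁ * a₃ / 2 ^ (ℓ + 1) * lx)) := by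
    refine Real.exp_le_exp.2 (neg_le_neg ?_)
    calc a₁ * a₃ / 2 ^ (ℓ + 1) * lx = a₁ * a₃ / 2 ^ (ℓ + 1) * lx * (x * ε) := by rw [hxε, mul_one]
      _ = 2 * (a₁ * ε / 2 ^ ℓ) * (a₃ * x * lx / 4) := by field_simp; ring
      _ ≤ _ := by gcongr
  have hv0 : I.coordError γ₀ γM M N 0 (M + N) ≤ ε / 10 := by
    refine (I.coordError_zero_le h0 h1 hI hγM0.le hγM2 hbox hℓ1 hℓN).trans ?_
    have t₁ : Real.exp (-(2 * (γM / 2 ^ ℓ) * (L - 1)))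
        * (Real.exp (-(2 * γM * L)) + γM * C) ≤ 1 / 20 * ε := by
      calc _ ≤ Real.exp (-(a₁ * a₃ / 2 ^ (ℓ + 1) * lx)) * (ε + b₁ * C * ε) := by
            gcongr
        _ = Real.exp (-(a₁ * a₃ / 2 ^ (ℓ + 1) * lx)) * (1 + b₁ * C) * ε := by ring
        _ ≤ 1 / 20 * ε := by gcongr
    have t₂ : γM / 2 ^ ℓ * C ≤ 1 / 20 * ε := by
      calc γM / 2 ^ ℓ * C = γM * C / 2 ^ ℓ := by ring
        _ ≤ b₁ * C * ε / 2 ^ ℓ := by gcongr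
        _ = b₁ * C / 2 ^ ℓ * ε := by ring
        _ ≤ 1 / 20 * ε := by gcongr
    linarith
  have hS := I.sum_coordError_succ_le (N := N) h0 h1 hI hγM0.le hbox
  -- `N γM²` is of order `ε log² x`, whereas `r = ε^{1/2}`. The `60` in the smallness condition is
  -- `3 * 20`.
  have hnoise : 3 * N * γM ^ 2 * C ≤ r / 20 := by
    have hb : 0 ≤ b₃ * (x * lx ^ 2) := hN0.le.trans hNb
    calc 3 * N * γM ^ 2 * C ≤ 3 * (b₃ * (x * lx ^ 2)) * (b₁ * ε) ^ 2 * C := by gcongr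
      _ = 60 * b₁ ^ 2 * C * b₃ * lx ^ 2 * (ε * (x * ε)) / 20 := by ring
      _ ≤ x ^ (1 / 2 : ℝ) * (ε * (x * ε)) / 20 := by gcongr
      _ = r / 20 := by
        rw [hxr, hxε, mul_one, ← hr2]
        field_simp
  rw [ShiftInstance.expectedRisk_eq, ShiftInstance.sum_targetSpectrum_mul]
  -- The weak coordinates carry weight `r`, so a total error of order `r` costs only order `ε`.
  have hrS : r * ∑ i : Fin I.K, I.coordError γ₀ γM M N i.succ (M + N) ≤ r * (r / 10) := by
    gcongr
    linarith
  have : r * (r / 10) = ε / 10 := by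
    rw [← hr2]
    ring
  linarith

end Finetuning

/-! ### The theorem. -/

theorem mainTheorem7 :
    -- the orders of the traces and of the signal strengths
    (∃ c > (0 : ℝ), ∃ C > (0 : ℝ), ∃ ε₀ > (0 : ℝ), ∀ ε : ℝ, 0 < ε → ε < ε₀ →
      ∀ (E : Type*) [NormedAddCommGroup E] [InnerProductSpace ℝ E] [CompleteSpace E]
        [SecondCountableTopology E] [MeasurableSpace E] [BorelSpace E] (I : ShiftInstance ε E),
      (c ≤ I.traceH ∧ I.traceH ≤ C) ∧ (c ≤ I.traceG ∧ I.traceG ≤ C) ∧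
      (c ≤ normSqOp I.H I.wStar ∧ normSqOp I.H I.wStar ≤ C) ∧
      (c ≤ normSqOp I.G I.wStar ∧ normSqOp I.G I.wStar ≤ C)) ∧
    -- supervised learning
    (∃ c > (0 : ℝ), ∃ ε₀ > (0 : ℝ), ∀ ε : ℝ, 0 < ε → ε < ε₀ →
      ∀ (E : Type*) [NormedAddCommGroup E] [InnerProductSpace ℝ E] [CompleteSpace E]
        [SecondCountableTopology E] [MeasurableSpace E] [BorelSpace E] (I : ShiftInstance ε E)
        (N : ℕ) (γ : ℝ), 0 < γ → γ < 1 / ‖I.H‖ →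
      I.expectedRisk γ γ 0 N < ε → c * ε ^ (-(3 / 2) : ℝ) ≤ N) ∧
    -- pretraining
    (∃ c > (0 : ℝ), ∃ ε₀ > (0 : ℝ), ∀ ε : ℝ, 0 < ε → ε < ε₀ →
      ∀ (E : Type*) [NormedAddCommGroup E] [InnerProductSpace ℝ E] [CompleteSpace E]
        [SecondCountableTopology E] [MeasurableSpace E] [BorelSpace E] (I : ShiftInstance ε E)
        (M : ℕ) (γ : ℝ), 0 < γ → γ < 1 / ‖I.G‖ →
      I.expectedRisk γ γ M 0 < ε → c * ε ^ (-2 : ℝ) ≤ M) ∧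
    -- pretraining-finetuning
    (∃ κ > (0 : ℝ), ∀ α a₀ a₁ b₁ a₂ b₂ a₃ b₃ : ℝ, 0 < α → 0 < a₀ → 0 < a₁ → 0 < a₂ → 0 < a₃ →
      κ ≤ a₁ * a₃ →
      ∃ ε₀ > (0 : ℝ), ∀ ε : ℝ, 0 < ε → ε < ε₀ →
      ∀ (E : Type*) [NormedAddCommGroup E] [InnerProductSpace ℝ E] [CompleteSpace E]
        [SecondCountableTopology E] [MeasurableSpace E] [BorelSpace E] (I : ShiftInstance ε E),
      I.FourthMoment α →
      ∀ (γ₀ γM : ℝ) (M N : ℕ),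
      a₀ ≤ γ₀ → γ₀ < 1 / (4 * α * I.traceG) → γ₀ < 1 / (4 * α * I.traceH) →
      a₁ * ε ≤ γM → γM ≤ b₁ * ε →
      a₂ * (ε⁻¹ * Real.log ε⁻¹) ≤ M → M ≤ b₂ * (ε⁻¹ * Real.log ε⁻¹) →
      a₃ * (ε⁻¹ * Real.log ε⁻¹ ^ 2) ≤ N → N ≤ b₃ * (ε⁻¹ * Real.log ε⁻¹ ^ 2) →
      Integrable (I.outputRisk γ₀ γM M N) (I.dataMeasure M) ∧
        I.expectedRisk γ₀ γM M N < ε) := by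
  refine ⟨⟨1, one_pos, 4, by norm_num, 1, one_pos, ?_⟩,
    ⟨1 / 8, by norm_num, 1 / 64, by norm_num, ?_⟩,
    ⟨1 / 2, by norm_num, 1 / 8, by norm_num, ?_⟩, 1, one_pos, ?_⟩
  · intro ε h0 h1 E _ _ _ _ _ _ I
    have hr : 0 < ε ^ (1 / 2 : ℝ) := by positivity
    have hr1 : ε ^ (1 / 2 : ℝ) ≤ 1 := Real.rpow_le_one h0.le h1.le (by norm_num)
    have hε2 : ε ^ 2 ≤ 1 := pow_le_one₀ h0.le h1.le
    refine ⟨⟨?_, I.traceH_le h0 h1⟩, ⟨?_, I.traceG_le h0 h1⟩, ?_, ?_⟩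
    · rw [I.traceH_eq]
      have : 0 ≤ I.K * ε ^ (1 / 2 : ℝ) := by positivity
      linarith
    · rw [I.traceG_eq h0 h1]
      linarith [sq_nonneg ε]
    · rw [I.normSqOp_H_wStar h0 h1]
      constructor <;> linarith
    · rw [I.normSqOp_G_wStar h0 h1]
      constructor <;> linarith [sq_nonneg ε]
  · intro ε h0 h1 E _ _ _ _ _ _ I N γ _ _ hrisk
    exact I.supervised_lower_bound h0 h1 hrisk
  · intro ε h0 h1 E _ _ _ _ _ _ I M γ hγ hγ1 hrisk
    exact I.pretraining_lower_bound h0 h1 hγ hγ1 hrisk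
  · intro α a₀ a₁ b₁ a₂ b₂ a₃ b₃ hα ha₀ ha₁ ha₂ ha₃ ha₁₃
    obtain ⟨ε₀, hε₀, h⟩ := ShiftInstance.expectedRisk_finetuning_lt (b₁ := b₁) (b₃ := b₃)
      hα ha₀ ha₁ ha₂ ha₃ ha₁₃
    refine ⟨ε₀, hε₀, fun ε h0 hε E _ _ _ _ _ _ I hI γ₀ γM M N h₁ h₂ _ h₄ h₅ h₆ _ h₈ h₉ => ?_⟩
    exact ⟨I.integrable_outputRisk, h ε h0 hε E I hI γ₀ γM M N h₁ h₂ h₄ h₅ h₆ h₈ h₉⟩
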